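/- Let $n\ge 1$ and let $\mathfrak g=Q(n)$ be the queer Lie superalgebra over $\mathbb C$, i.e. the Lie subsuperalgebra of $\mathfrak{gl}(n|n)$ of all block matrices $\left(\begin{smallmatrix}A&B\\B&A\end{smallmatrix}\right)$ with $A,B\in \mathrm{Mat}_n(\mathbb C)$. Let $e_{i,j}$ (resp. $f_{i,j}$) be the element with $A=E_{ij}$, $B=0$ (resp. $A=0$, $B=E_{ij}$), and put $\operatorname{otr}\left(\begin{smallmatrix}A&B\\C&D\end{smallmatrix}\right)=\operatorname{tr}B$. Let $\chi\in\mathfrak g^*$ be the regular nilpotent even functional $\chi(x)=\operatorname{otr}(xE)$, where $E=\sum_{i=1}^{n-1}f_{i,i+1}$. Let $h\in\mathfrak g_{\bar 0}$ be the element with $A=\operatorname{diag}(n-1,n-3,\dots,1-n)$, $B=0$, let $\mathfrak g_j=\{x\in\mathfrak g : [h,x]=jx\}$, and let $\mathfrak m=\bigoplus_{j=1}^{n-1}\mathfrak g_{-2j}$. Let $I_\chi$ be the left ideal of the universal enveloping superalgebra $U(\mathfrak g)$ generated by $a-\chi(a)$, $a\in\mathfrak m$, let $Q_\chi=U(\mathfrak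 g)/I_\chi$ with projection $\pi:U(\mathfrak g)\to Q_\chi$, and let $W_\chi=\operatorname{End}_{U(\mathfrak g)}(Q_\chi)^{op}$ be the finite $W$-algebra. Via $\varphi\mapsto\varphi(\pi(1))$, $W_\chi$ is identified with $\{v\in Q_\chi : av=\chi(a)v \text{ for all } a\in\mathfrak m\}$, with product $\pi(y_1)\pi(y_2)=\pi(y_1y_2)$. Define $e_{i,j}^{(m)},f_{i,j}^{(m)}\in U(\mathfrak g)$ for $m\ge 1$ by $e_{i,j}^{(1)}=e_{i,j}$, $f_{i,j}^{(1)}=f_{i,j}$ and, for $m\ge 2$, $$e_{i,j}^{(m)}=\sum_{k=1}^n e_{i,k}e_{k,j}^{(m-1)}+(-1)^{m+1}\sum_{k=1}^n f_{i,k}f_{k,j}^{(m-1)},\qquad f_{i,j}^{(m)}=\sum_{k=1}^n e_{i,k}f_{k,j}^{(m-1)}+(-1)^{m+1}\sum_{k=1}^n f_{i,k}e_{k,j}^{(m-1)}.$$ Then the elements $\pi(e_{n,1}^{(m)})$ and $\pi(f_{n,1}^{(m)})$ for $m=n,\dots,2n-1$ lie in $W_\chi$ and generate $W_\chi$ as an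 algebra. Moreover, the natural algebra homomorphism $U(\mathfrak g)^{\operatorname{ad}\mathfrak m}\to W_\chi$, $u\mapsto\pi(u)$, is surjective, where $U(\mathfrak g)^{\operatorname{ad}\mathfrak m}$ is the subalgebra of all $u\in U(\mathfrak g)$ with $\operatorname{ad}(a)(u)=0$ for all $a\in\mathfrak m$, and $\operatorname{ad}(a)(u)=au-(-1)^{|a||u|}ua$ for homogeneous $a$, $u$. -/

import Mathlib

noncomputable section

namespace QueerW

open Matrix

/-- Square complex matrices of size `2n`, written in four `n × n` blocks: the space `gl(n|n)`. -/
abbrev BlockMat (n : ℕ) := Matrix (Fin n ⊕ Fin n) (Fin n ⊕ Fin n) ℂ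

/-- The even (block diagonal) component of a block matrix. -/
def evenPart (n : ℕ) : BlockMat n →ₗ[ℂ] BlockMat n where
  toFun X := fromBlocks X.toBlocks₁₁ 0 0 X.toBlocks₂₂
  map_add' X Y := by
    ext (i | i) (j | j) <;> simp [toBlocks₁₁, toBlocks₂₂]
  map_smul' c X := by
    ext (i | i) (j | j) <;> simp [toBlocks₁₁, toBlocks₂₂]

/-- The odd (block off-diagonal) component of a block matrix. -/
def oddPart (n : ℕ) : BlockMat n →ₗ[ℂ] BlockMat n where
  toFun X := fromBlocks 0 X.toBlocks₁₂ X.toBlocks₂₁ 0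
  map_add' X Y := by
    ext (i | i) (j | j) <;> simp [toBlocks₁₂, toBlocks₂₁]
  map_smul' c X := by
    ext (i | i) (j | j) <;> simp [toBlocks₁₂, toBlocks₂₁]

@[simp] theorem evenPart_fromBlocks {n : ℕ} (A B C D : Matrix (Fin n) (Fin n) ℂ) :
    evenPart n (fromBlocks A B C D) = fromBlocks A 0 0 D := by
  simp [evenPart]

@[simp] theorem oddPart_fromBlocks {n : ℕ} (A B C D : Matrix (Fin n) (Fin n) ℂ) :
    oddPart n (fromBlocks A B C D) = fromBlocks 0 B C 0 := by
  simp [oddPart]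

/-- The supercommutator of `gl(n|n)`: the bilinear extension of
`[X, Y] = X Y - (-1)^{|X||Y|} Y X` from homogeneous `X`, `Y`. -/
def superBracket {n : ℕ} (X Y : BlockMat n) : BlockMat n :=
  X * Y - evenPart n Y * X - oddPart n Y * evenPart n X + oddPart n Y * oddPart n X

/-- The queer Lie superalgebra `Q(n)`, inside `gl(n|n)`. -/
def queer (n : ℕ) : Submodule ℂ (BlockMat n) where
  carrier := {X | ∃ A B : Matrix (Fin n) (Fin n) ℂ, X = fromBlocks A B B A}
  add_mem' := by
    rintro _ _ ⟨A, B, rfl⟩ ⟨A', B', rfl⟩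
    exact ⟨A + A', B + B', by simp [fromBlocks_add]⟩
  zero_mem' := ⟨0, 0, by simp⟩
  smul_mem' := by
    rintro c _ ⟨A, B, rfl⟩
    exact ⟨c • A, c • B, by simp [fromBlocks_smul]⟩

theorem superBracket_fromBlocks {n : ℕ} (A B A' B' : Matrix (Fin n) (Fin n) ℂ) :
    superBracket (fromBlocks A B B A) (fromBlocks A' B' B' A') =
      fromBlocks (A * A' - A' * A + (B * B' + B' * B)) (A * B' - B' * A + (B * A' - A' * B))
        (A * B' - B' * A + (B * A' - A' * B)) (A * A' - A' * A + (B * B' + B' * B)) := by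
  simp only [superBracket, evenPart_fromBlocks, oddPart_fromBlocks, fromBlocks_multiply,
    sub_eq_add_neg, fromBlocks_neg, fromBlocks_add]
  congr 1 <;> simp <;> abel

instance (n : ℕ) : Bracket (queer n) (queer n) where
  bracket X Y := ⟨superBracket (X : BlockMat n) (Y : BlockMat n), by
    obtain ⟨_, A, B, rfl⟩ := X
    obtain ⟨_, A', B', rfl⟩ := Y
    exact ⟨_, _, superBracket_fromBlocks A B A' B'⟩⟩

theorem coe_bracket {n : ℕ} (X Y : queer n) :
    ((⁅X, Y⁆ : queer n) : BlockMat n) = superBracket (X : BlockMat n) (Y : BlockMat n) := rfl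

/-- The element of `Q(n)` with diagonal blocks `A` and off-diagonal blocks `B`. -/
def block {n : ℕ} (A B : Matrix (Fin n) (Fin n) ℂ) : queer n := ⟨fromBlocks A B B A, A, B, rfl⟩

theorem exists_block {n : ℕ} (x : queer n) :
    ∃ A B : Matrix (Fin n) (Fin n) ℂ, x = block A B := by
  obtain ⟨_, A, B, rfl⟩ := x
  exact ⟨A, B, rfl⟩

theorem block_add {n : ℕ} (A B A' B' : Matrix (Fin n) (Fin n) ℂ) :
    block A B + block A' B' = block (A + A') (B + B') :=
  Subtype.ext (fromBlocks_add _ _ _ _ _ _ _ _)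

theorem block_smul {n : ℕ} (c : ℂ) (A B : Matrix (Fin n) (Fin n) ℂ) :
    c • block A B = block (c • A) (c • B) :=
  Subtype.ext (fromBlocks_smul _ _ _ _ _)

theorem block_neg {n : ℕ} (A B : Matrix (Fin n) (Fin n) ℂ) :
    -block A B = block (-A) (-B) :=
  Subtype.ext (fromBlocks_neg _ _ _ _)

theorem block_bracket {n : ℕ} (A B A' B' : Matrix (Fin n) (Fin n) ℂ) :
    ⁅block A B, block A' B'⁆ =
      block (A * A' - A' * A + (B * B' + B' * B)) (A * B' - B' * A + (B * A' - A' * B)) :=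
  Subtype.ext (superBracket_fromBlocks A B A' B')

/-- The projection of `Q(n)` to its even part. -/
def queerEven (n : ℕ) : queer n →ₗ[ℂ] queer n :=
  (evenPart n).restrict (by
    rintro _ ⟨A, B, rfl⟩
    exact ⟨A, 0, by simp⟩)

/-- The projection of `Q(n)` to its odd part. -/
def queerOdd (n : ℕ) : queer n →ₗ[ℂ] queer n :=
  (oddPart n).restrict (by
    rintro _ ⟨A, B, rfl⟩
    exact ⟨0, B, by simp⟩)

@[simp] theorem queerEven_block {n : ℕ} (A B : Matrix (Fin n) (Fin n) ℂ) :
    queerEven n (block A B) = block A 0 :=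
  Subtype.ext (evenPart_fromBlocks A B B A)

@[simp] theorem queerOdd_block {n : ℕ} (A B : Matrix (Fin n) (Fin n) ℂ) :
    queerOdd n (block A B) = block 0 B :=
  Subtype.ext (oddPart_fromBlocks A B B A)

theorem even_add_odd {n : ℕ} (x : queer n) : queerEven n x + queerOdd n x = x := by
  obtain ⟨A, B, rfl⟩ := exists_block x
  simp [block_add]

/-- The homogeneous elements of `Q(n)` of parity `0` or `1`. -/
def queerParity (n : ℕ) (p : Fin 2) : Submodule ℂ (queer n) :=
  if p = 0 then LinearMap.range (queerEven n) else LinearMap.range (queerOdd n)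

/-- The standard basis elements `e_{ij}` of the even part. -/
def e {n : ℕ} (i j : Fin n) : queer n :=
  block (Matrix.single i j 1) 0

/-- The standard basis elements `f_{ij}` of the odd part. -/
def f {n : ℕ} (i j : Fin n) : queer n :=
  block 0 (Matrix.single i j 1)

/-- The defining relations of the enveloping algebra:
`x y - (-1)^{|x||y|} y x = [x, y]` for homogeneous `x`, `y`. -/
inductive EnvRel (n : ℕ) : TensorAlgebra ℂ (queer n) → TensorAlgebra ℂ (queer n) → Prop
  | super_comm (p q : Fin 2) (x y : queer n) (hx : x ∈ queerParity n p) (hy : y ∈ queerParity n q) :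
      EnvRel n
        (TensorAlgebra.ι ℂ x * TensorAlgebra.ι ℂ y -
          (-1 : ℂ) ^ ((p : ℕ) * (q : ℕ)) • (TensorAlgebra.ι ℂ y * TensorAlgebra.ι ℂ x))
        (TensorAlgebra.ι ℂ ⁅x, y⁆)

/-- The universal enveloping (super)algebra `U(Q(n))`. -/
def Env (n : ℕ) : Type := RingQuot (EnvRel n)

instance (n : ℕ) : Ring (Env n) := inferInstanceAs (Ring (RingQuot (EnvRel n)))

instance (n : ℕ) : Algebra ℂ (Env n) := inferInstanceAs (Algebra ℂ (RingQuot (EnvRel n)))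

/-- The canonical map `Q(n) → U(Q(n))`. -/
def ι (n : ℕ) : queer n →ₗ[ℂ] Env n :=
  (RingQuot.mkAlgHom ℂ (EnvRel n)).toLinearMap ∘ₗ TensorAlgebra.ι ℂ

/-- The universal property of `U(Q(n))`. -/
def lift {n : ℕ} {A : Type*} [Ring A] [Algebra ℂ A] (g : queer n →ₗ[ℂ] A)
    (hg : ∀ (p q : Fin 2) (x y : queer n), x ∈ queerParity n p → y ∈ queerParity n q →
      g x * g y - (-1 : ℂ) ^ ((p : ℕ) * (q : ℕ)) • (g y * g x) = g ⁅x, y⁆) :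
    Env n →ₐ[ℂ] A :=
  RingQuot.liftAlgHom ℂ ⟨TensorAlgebra.lift ℂ g, by
    rintro _ _ ⟨p, q, x, y, hx, hy⟩
    simpa using hg p q x y hx hy⟩

theorem lift_ι {n : ℕ} {A : Type*} [Ring A] [Algebra ℂ A] (g : queer n →ₗ[ℂ] A)
    (hg : ∀ (p q : Fin 2) (x y : queer n), x ∈ queerParity n p → y ∈ queerParity n q →
      g x * g y - (-1 : ℂ) ^ ((p : ℕ) * (q : ℕ)) • (g y * g x) = g ⁅x, y⁆) (x : queer n) :
    lift g hg (ι n x) = g x := by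
  have h := RingQuot.liftAlgHom_mkAlgHom_apply ℂ (TensorAlgebra.lift ℂ g) (s := EnvRel n) (by
    rintro _ _ ⟨p, q, x, y, hx, hy⟩
    simpa using hg p q x y hx hy) (TensorAlgebra.ι ℂ x)
  rw [TensorAlgebra.lift_ι_apply] at h
  exact h

theorem ι_superComm {n : ℕ} (p q : Fin 2) (x y : queer n)
    (hx : x ∈ queerParity n p) (hy : y ∈ queerParity n q) :
    ι n x * ι n y - (-1 : ℂ) ^ ((p : ℕ) * (q : ℕ)) • (ι n y * ι n x) = ι n ⁅x, y⁆ := by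
  have h := RingQuot.mkAlgHom_rel ℂ (EnvRel.super_comm p q x y hx hy)
  rw [map_sub, map_smul, map_mul, map_mul] at h
  exact h

theorem parity_relation {n : ℕ} (p q : Fin 2) (x y : queer n)
    (hx : x ∈ queerParity n p) (hy : y ∈ queerParity n q) :
    (ι n ∘ₗ (queerEven n - queerOdd n)) x * (ι n ∘ₗ (queerEven n - queerOdd n)) y -
      (-1 : ℂ) ^ ((p : ℕ) * (q : ℕ)) •
        ((ι n ∘ₗ (queerEven n - queerOdd n)) y * (ι n ∘ₗ (queerEven n - queerOdd n)) x) =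
      (ι n ∘ₗ (queerEven n - queerOdd n)) ⁅x, y⁆ := by
  have key : ∀ (r : Fin 2) (z : queer n), z ∈ queerParity n r →
      (queerEven n - queerOdd n) z ∈ queerParity n r := by
    intro r z hz
    fin_cases r
    · obtain ⟨z, rfl⟩ := hz
      obtain ⟨A, B, rfl⟩ := exists_block z
      exact ⟨block A B, by simp [sub_eq_add_neg, block_neg, block_add]⟩
    · obtain ⟨z, rfl⟩ := hz
      obtain ⟨A, B, rfl⟩ := exists_block z
      exact ⟨block A (-B), by simp [sub_eq_add_neg, block_neg, block_add]⟩
  simp only [LinearMap.comp_apply]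
  rw [ι_superComm p q _ _ (key p x hx) (key q y hy)]
  congr 1
  obtain ⟨A, B, rfl⟩ := exists_block x
  obtain ⟨A', B', rfl⟩ := exists_block y
  simp only [LinearMap.sub_apply, queerEven_block, queerOdd_block, block_bracket, sub_eq_add_neg,
    block_neg, block_add]
  congr 1 <;> simp <;> abel

/-- The parity automorphism of `U(Q(n))`: multiplication by `(-1)^{|u|}` on homogeneous `u`. -/
def parity (n : ℕ) : Env n →ₐ[ℂ] Env n :=
  lift (ι n ∘ₗ (queerEven n - queerOdd n)) parity_relation

/-- The adjoint action of `Q(n)` on `U(Q(n))`: the linear extension of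
`ad(a)(u) = a u - (-1)^{|a||u|} u a` from homogeneous `a`, `u`. -/
def adAction {n : ℕ} (a : queer n) (u : Env n) : Env n :=
  ι n a * u - u * ι n (queerEven n a) - parity n u * ι n (queerOdd n a)

/-- `h = diag(n-1, n-3, …, 1-n)` (in both diagonal blocks). -/
def hElt (n : ℕ) : queer n :=
  block (diagonal fun i : Fin n => (n : ℂ) - 1 - 2 * (i : ℕ)) 0

/-- The degree `j` component of the Dynkin grading, `{x | [h, x] = j x}`. -/
def dynkin (n : ℕ) (j : ℤ) : Submodule ℂ (queer n) where
  carrier := {x | ⁅hElt n, x⁆ = (j : ℂ) • x}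
  add_mem' := by
    intro x y (hx : ⁅hElt n, x⁆ = (j : ℂ) • x) (hy : ⁅hElt n, y⁆ = (j : ℂ) • y)
    change ⁅hElt n, x + y⁆ = (j : ℂ) • (x + y)
    have h : ⁅hElt n, x + y⁆ = ⁅hElt n, x⁆ + ⁅hElt n, y⁆ := by
      apply Subtype.ext
      simp only [coe_bracket, superBracket, Submodule.coe_add, map_add, mul_add, add_mul]
      abel
    rw [h, hx, hy, smul_add]
  zero_mem' := by
    apply Subtype.ext
    simp [coe_bracket, superBracket]
  smul_mem' := by
    intro c x (hx : ⁅hElt n, x⁆ = (j : ℂ) • x)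
    change ⁅hElt n, c • x⁆ = (j : ℂ) • (c • x)
    have h : ⁅hElt n, c • x⁆ = c • ⁅hElt n, x⁆ := by
      apply Subtype.ext
      simp only [coe_bracket, superBracket, Submodule.coe_smul, map_smul, mul_smul_comm,
        smul_mul_assoc, smul_add, smul_sub]
    rw [h, hx, smul_comm]

/-- The nilpotent subalgebra `m = ⨁_{j=1}^{n-1} g_{-2j}`. -/
def nilM (n : ℕ) : Submodule ℂ (queer n) :=
  ⨆ j ∈ Finset.Icc 1 (n - 1), dynkin n (-2 * (j : ℤ))

theorem block_mem_dynkin {n : ℕ} (j : ℤ) (A B : Matrix (Fin n) (Fin n) ℂ) :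
    block A B ∈ dynkin n j ↔ block A 0 ∈ dynkin n j ∧ block 0 B ∈ dynkin n j := by
  have key : ∀ A B A' B' : Matrix (Fin n) (Fin n) ℂ,
      block A B = block A' B' ↔ A = A' ∧ B = B' := by
    intro A B A' B'
    constructor
    · intro h
      have h2 := fromBlocks_inj.1 (congrArg Subtype.val h)
      exact ⟨h2.1, h2.2.1⟩
    · rintro ⟨rfl, rfl⟩
      rfl
  change ⁅hElt n, _⁆ = _ ↔ ⁅hElt n, _⁆ = _ ∧ ⁅hElt n, _⁆ = _
  simp [hElt, block_bracket, block_smul, key]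

theorem queerEven_mem_nilM {n : ℕ} {x : queer n} (hx : x ∈ nilM n) : queerEven n x ∈ nilM n := by
  have h : nilM n ≤ (nilM n).comap (queerEven n) := by
    refine iSup₂_le fun j hj y hy => ?_
    obtain ⟨A, B, rfl⟩ := exists_block y
    have h2 := ((block_mem_dynkin _ A B).1 hy).1
    rw [Submodule.mem_comap, queerEven_block]
    exact Submodule.mem_iSup_of_mem j (Submodule.mem_iSup_of_mem hj h2)
  exact h hx

theorem queerOdd_mem_nilM {n : ℕ} {x : queer n} (hx : x ∈ nilM n) : queerOdd n x ∈ nilM n := by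
  have h : nilM n ≤ (nilM n).comap (queerOdd n) := by
    refine iSup₂_le fun j hj y hy => ?_
    obtain ⟨A, B, rfl⟩ := exists_block y
    have h2 := ((block_mem_dynkin _ A B).1 hy).2
    rw [Submodule.mem_comap, queerOdd_block]
    exact Submodule.mem_iSup_of_mem j (Submodule.mem_iSup_of_mem hj h2)
  exact h hx

/-- The odd trace: the trace of the upper right block. -/
def otr {n : ℕ} (X : BlockMat n) : ℂ := X.toBlocks₁₂.trace

/-- `E = ∑_{i=1}^{n-1} f_{i,i+1}`. -/
def EElt (n : ℕ) : queer n :=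
  ∑ i : Fin n, ∑ j : Fin n, if (i : ℕ) + 1 = (j : ℕ) then f i j else 0

/-- The regular nilpotent functional `χ(x) = otr (x E)`. -/
def chi (n : ℕ) : queer n →ₗ[ℂ] ℂ where
  toFun x := otr ((x : BlockMat n) * (EElt n : BlockMat n))
  map_add' x y := by
    simp only [otr, Submodule.coe_add, add_mul]
    rw [← Matrix.trace_add]; rfl
  map_smul' c x := by
    simp only [otr, Submodule.coe_smul, smul_mul_assoc, RingHom.id_apply]
    rw [← Matrix.trace_smul]; rfl

theorem EElt_eq (n : ℕ) : EElt n =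
    block 0 (Matrix.of fun i j : Fin n => if (i : ℕ) + 1 = (j : ℕ) then 1 else 0) := by
  have hS : ∀ (s : Finset (Fin n)) (g : Fin n → Matrix (Fin n) (Fin n) ℂ),
      ∑ i ∈ s, block 0 (g i) = block 0 (∑ i ∈ s, g i) := by
    intro s g
    classical
    induction s using Finset.induction_on with
    | empty => exact Subtype.ext (by simp [block])
    | insert a s ha ih => rw [Finset.sum_insert ha, Finset.sum_insert ha, ih, block_add, add_zero]
  have h0 : (0 : queer n) = block 0 0 := Subtype.ext (by simp [block])
  have h1 : ∀ i j : Fin n, (if (i : ℕ) + 1 = (j : ℕ) then f i j else 0) =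
      block 0 (if (i : ℕ) + 1 = (j : ℕ) then Matrix.single i j (1 : ℂ) else 0) := by
    intro i j
    split_ifs
    · rfl
    · exact h0
  simp only [EElt, h1, hS]
  congr 1
  ext k l
  simp only [Matrix.sum_apply, Matrix.of_apply]
  rw [Finset.sum_eq_single k, Finset.sum_eq_single l]
  · split_ifs <;> simp
  · intro j _ hj
    split_ifs <;> simp [Matrix.single, hj]
  · simp
  · intro i _ hi
    refine Finset.sum_eq_zero fun j _ => ?_
    split_ifs <;> simp [Matrix.single, hi]
  · simp

theorem chi_odd {n : ℕ} (a : queer n) : chi n (queerOdd n a) = 0 := by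
  obtain ⟨A, B, rfl⟩ := exists_block a
  rw [queerOdd_block]
  change otr ((block 0 B : BlockMat n) * (EElt n : BlockMat n)) = 0
  rw [EElt_eq]
  simp [block, otr, fromBlocks_multiply]

/-- The left ideal `I_χ` of `U(Q(n))` generated by `a - χ(a)`, `a ∈ m`. -/
def leftIdeal (n : ℕ) : Submodule (Env n) (Env n) :=
  Submodule.span (Env n) {u | ∃ a ∈ nilM n, u = ι n a - algebraMap ℂ (Env n) (chi n a)}

/-- The generalized Whittaker module `Q_χ = U(Q(n)) / I_χ`. -/
abbrev WhittakerModule (n : ℕ) := Env n ⧸ leftIdeal n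

/-- The natural projection `π : U(Q(n)) → U(Q(n)) / I_χ`. -/
def proj (n : ℕ) : Env n →ₗ[Env n] WhittakerModule n := (leftIdeal n).mkQ

/-- The finite `W`-algebra `W_χ = End_{U(Q(n))}(Q_χ)^{op}`. -/
abbrev FiniteW (n : ℕ) := (Module.End (Env n) (WhittakerModule n))ᵐᵒᵖ

/-- The Whittaker vectors `{v ∈ Q_χ | a v = χ(a) v for all a ∈ m}`. -/
def whittakerVectors (n : ℕ) : Submodule ℂ (WhittakerModule n) where
  carrier := {v | ∀ a ∈ nilM n, ι n a • v = chi n a • v}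
  add_mem' := by
    intro v w hv hw a ha
    rw [smul_add, smul_add, hv a ha, hw a ha]
  zero_mem' := by
    intro a _
    rw [smul_zero, smul_zero]
  smul_mem' := by
    intro c v hv a ha
    rw [smul_comm, hv a ha, smul_comm]

theorem proj_gen {n : ℕ} (a : queer n) (ha : a ∈ nilM n) :
    ι n a • proj n 1 = chi n a • proj n 1 := by
  have h : proj n (ι n a - algebraMap ℂ (Env n) (chi n a)) = 0 := by
    rw [proj, Submodule.mkQ_apply, Submodule.Quotient.mk_eq_zero]
    exact Submodule.subset_span ⟨a, ha, rfl⟩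
  rw [map_sub, sub_eq_zero] at h
  rw [← map_smul, smul_eq_mul, mul_one, h, Algebra.algebraMap_eq_smul_one]
  rfl

/-- The identification of `W_χ` with the space of Whittaker vectors, `φ ↦ φ(π(1))`. -/
def wEquiv (n : ℕ) : FiniteW n ≃ₗ[ℂ] whittakerVectors n where
  toFun w := ⟨w.unop (proj n 1), by
    intro a ha
    rw [← map_smul, proj_gen a ha]
    exact LinearMap.map_smul_of_tower w.unop (chi n a) (proj n 1)⟩
  map_add' _ _ := rfl
  map_smul' _ _ := rfl
  invFun v := MulOpposite.op <| (leftIdeal n).liftQ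
    (LinearMap.toSpanSingleton (Env n) (WhittakerModule n) (v : WhittakerModule n)) (by
      refine Submodule.span_le.2 ?_
      rintro _ ⟨a, ha, rfl⟩
      have := v.2 a ha
      simp [sub_smul, this])
  left_inv w := by
    apply MulOpposite.unop_injective
    refine LinearMap.ext fun q => ?_
    obtain ⟨u, rfl⟩ := (leftIdeal n).mkQ_surjective q
    have h : (leftIdeal n).mkQ u = u • proj n 1 := by
      rw [← map_smul, smul_eq_mul, mul_one]; rfl
    conv_rhs => rw [h, map_smul]
    rfl
  right_inv v := by
    apply Subtype.ext
    exact one_smul (Env n) (v : WhittakerModule n)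

/-- The product of `W_χ` in terms of Whittaker vectors: `π(y₁) π(y₂) = π(y₁ y₂)`. -/
theorem wEquiv_mul {n : ℕ} (w₁ w₂ : FiniteW n) (y₁ y₂ : Env n)
    (h₁ : (wEquiv n w₁ : WhittakerModule n) = proj n y₁)
    (h₂ : (wEquiv n w₂ : WhittakerModule n) = proj n y₂) :
    (wEquiv n (w₁ * w₂) : WhittakerModule n) = proj n (y₁ * y₂) := by
  change w₁.unop (proj n 1) = _ at h₁
  change w₂.unop (proj n 1) = _ at h₂
  change w₂.unop (w₁.unop (proj n 1)) = _
  have h : ∀ y z : Env n, proj n (y * z) = y • proj n z := fun y z => map_smul (proj n) y z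
  have h3 := h y₁ 1
  rw [mul_one] at h3
  rw [h₁, h3, map_smul, h₂, h]

theorem queerEven_odd {n : ℕ} (a : queer n) :
    queerEven n (queerEven n a) = queerEven n a ∧ queerOdd n (queerOdd n a) = queerOdd n a ∧
      queerEven n (queerOdd n a) = 0 ∧ queerOdd n (queerEven n a) = 0 := by
  obtain ⟨A, B, rfl⟩ := exists_block a
  have h : block (0 : Matrix (Fin n) (Fin n) ℂ) 0 = 0 := Subtype.ext (by simp [block])
  simp [h]

theorem adInvariant_comm {n : ℕ} {u : Env n} (hu : ∀ a ∈ nilM n, adAction a u = 0) {a : queer n}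
    (ha : a ∈ nilM n) :
    ι n a * u = u * ι n (queerEven n a) + parity n u * ι n (queerOdd n a) := by
  have h := hu a ha
  rwa [adAction, sub_sub, sub_eq_zero] at h

theorem adInvariant_even {n : ℕ} {u : Env n} (hu : ∀ a ∈ nilM n, adAction a u = 0) {a : queer n}
    (ha : a ∈ nilM n) : ι n (queerEven n a) * u = u * ι n (queerEven n a) := by
  have h := adInvariant_comm hu (queerEven_mem_nilM ha)
  obtain ⟨h1, h2, h3, h4⟩ := queerEven_odd a
  simpa [h1, h4] using h

theorem adInvariant_odd {n : ℕ} {u : Env n} (hu : ∀ a ∈ nilM n, adAction a u = 0) {a : queer n}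
    (ha : a ∈ nilM n) : ι n (queerOdd n a) * u = parity n u * ι n (queerOdd n a) := by
  have h := adInvariant_comm hu (queerOdd_mem_nilM ha)
  obtain ⟨h1, h2, h3, h4⟩ := queerEven_odd a
  simpa [h2, h3] using h

/-- The subalgebra `U(Q(n))^{ad m}` of `ad m`-invariants. -/
def adInvariants (n : ℕ) : Subalgebra ℂ (Env n) where
  carrier := {u | ∀ a ∈ nilM n, adAction a u = 0}
  mul_mem' := by
    intro u v hu hv a ha
    have hu' := adInvariant_comm hu ha
    have h0 := adInvariant_even hv ha
    have h1 := adInvariant_odd hv ha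
    simp only [adAction, map_mul]
    rw [← mul_assoc, hu', add_mul, mul_assoc, h0, mul_assoc, h1]
    simp only [mul_assoc]
    abel
  add_mem' := by
    intro u v hu hv a ha
    have hu' := hu a ha
    have hv' := hv a ha
    simp only [adAction, map_add, mul_add, add_mul] at *
    rw [← add_zero (0 : Env n)]
    nth_rewrite 1 [← hu']
    rw [← hv']
    abel
  algebraMap_mem' := by
    intro c a _
    simp only [adAction, AlgHom.commutes]
    rw [sub_sub, ← mul_add, ← map_add, even_add_odd, Algebra.commutes, sub_self]

/-- Right multiplication by an `ad m`-invariant on `Q_χ`. -/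
def rightMul {n : ℕ} (u : adInvariants n) : Module.End (Env n) (WhittakerModule n) :=
  (leftIdeal n).mapQ (leftIdeal n) (LinearMap.toSpanSingleton (Env n) (Env n) (u : Env n)) (by
    refine Submodule.span_le.2 ?_
    rintro _ ⟨a, ha, rfl⟩
    have h : (ι n a - algebraMap ℂ (Env n) (chi n a)) * (u : Env n) =
        (u : Env n) * (ι n (queerEven n a) - algebraMap ℂ (Env n) (chi n (queerEven n a))) +
        parity n u * (ι n (queerOdd n a) - algebraMap ℂ (Env n) (chi n (queerOdd n a))) := by
      have h0 : chi n (queerEven n a) = chi n a := by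
        conv_rhs => rw [← even_add_odd a, map_add, chi_odd, add_zero]
      rw [chi_odd, h0, map_zero, sub_zero, sub_mul, adInvariant_comm u.2 ha, mul_sub,
        Algebra.commutes]
      abel
    change (ι n a - algebraMap ℂ (Env n) (chi n a)) * (u : Env n) ∈ leftIdeal n
    rw [h]
    exact add_mem
      ((leftIdeal n).smul_mem _ (Submodule.subset_span ⟨_, queerEven_mem_nilM ha, rfl⟩))
      ((leftIdeal n).smul_mem _ (Submodule.subset_span ⟨_, queerOdd_mem_nilM ha, rfl⟩)))

theorem rightMul_proj {n : ℕ} (u : adInvariants n) (y : Env n) :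
    rightMul u (proj n y) = proj n (y * u) := rfl

theorem proj_surjective (n : ℕ) : Function.Surjective (proj n) := (leftIdeal n).mkQ_surjective

/-- The natural homomorphism `U(Q(n))^{ad m} → W_χ`, sending `u` to the class `π(u)`, that is, to
right multiplication by `u` on `Q_χ`. -/
def invariantsToW (n : ℕ) : adInvariants n →ₐ[ℂ] FiniteW n :=
  AlgHom.ofLinearMap
    { toFun := fun u => MulOpposite.op (rightMul u)
      map_add' := by
        intro u v
        apply MulOpposite.unop_injective
        refine LinearMap.ext fun q => ?_
        obtain ⟨y, rfl⟩ := proj_surjective n q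
        change proj n (y * (u + v)) = proj n (y * u) + proj n (y * v)
        rw [mul_add, map_add]
      map_smul' := by
        intro c u
        apply MulOpposite.unop_injective
        refine LinearMap.ext fun q => ?_
        obtain ⟨y, rfl⟩ := proj_surjective n q
        change proj n (y * (c • (u : Env n))) = c • proj n (y * u)
        rw [mul_smul_comm]
        rfl }
    (by
      apply MulOpposite.unop_injective
      refine LinearMap.ext fun q => ?_
      obtain ⟨y, rfl⟩ := proj_surjective n q
      change proj n (y * 1) = proj n y
      rw [mul_one])
    (by
      intro u v
      apply MulOpposite.unop_injective
      refine LinearMap.ext fun q => ?_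
      obtain ⟨y, rfl⟩ := proj_surjective n q
      change proj n (y * (u * v)) = proj n (y * u * v)
      rw [mul_assoc])

theorem wEquiv_invariantsToW {n : ℕ} (u : adInvariants n) :
    (wEquiv n (invariantsToW n u) : WhittakerModule n) = proj n u := by
  change proj n (1 * (u : Env n)) = proj n u
  rw [one_mul]

mutual

/-- The elements `e_{ij}^{(m)}` of `U(Q(n))`; the recursion is started at `m = 0` with
`e_{ij}^{(0)} = δ_{ij}`, `f_{ij}^{(0)} = 0`, which gives `e_{ij}^{(1)} = e_{ij}` and
`f_{ij}^{(1)} = f_{ij}`. -/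
def eElt {n : ℕ} : ℕ → Fin n → Fin n → Env n
  | 0, i, j => if i = j then 1 else 0
  | m + 1, i, j => ∑ k, ι n (e i k) * eElt m k j +
      (-1 : ℂ) ^ (m + 2) • ∑ k, ι n (f i k) * fElt m k j

/-- The elements `f_{ij}^{(m)}` of `U(Q(n))`. -/
def fElt {n : ℕ} : ℕ → Fin n → Fin n → Env n
  | 0, _, _ => 0
  | m + 1, i, j => ∑ k, ι n (e i k) * fElt m k j +
      (-1 : ℂ) ^ (m + 2) • ∑ k, ι n (f i k) * eElt m k j

end

end QueerW

end

namespace QueerW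

-- A basis element in position `(i, j)` gets Kazhdan degree `j - i + 1`. A supercommutator has
-- degree one less than the product, so on the associated graded space of `Q_χ` the basis elements
-- supercommute, each `e_{i+1,i}` acts as the identity, and the rest of `m` acts as zero.
--
-- The supercommutator of a basis element in position `(i, j)` with `e_{k,l}^{(m)}` or
-- `f_{k,l}^{(m)}` has only terms carrying `δ_{jk}` or `δ_{il}` (`gen_mul_power`). For `(k, l) = (n,
-- 1)` and `i > j` both vanish, so the proposed generators already come from `ad m`-invariants.
-- Following subdiagonal steps through the matrix product shows that, for `n ≤ m ≤ 2n - 1`, their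
-- leading terms are, up to sign, the entries `e_{2n-m,n}`, `f_{2n-m,n}` of the last column, modulo
-- decomposables (`power_smul_sub_mem_decomposable`). Hence `Q_χ` is spanned by words in the upper
-- triangular entries with the last column replaced by invariants (`kazhdan_le_wordSpan_letter`).
--
-- The other letters must disappear from the leading part of a Whittaker vector `v`. Let `y` be the
-- letter at `(i, j)` with `j < n`. The element of `m` of the same parity at `(j+1, i)`, minus its
-- value under `χ`, acts as a superderivation `∂` with `∂y = 1`, and it kills the invariants and all
-- letters preceding `y` in a suitable order (`nilOp_word_mem`). Write `v = w + y u` with `w` free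
-- of `y` and of later letters. Then `∂v = 0` gives `u ± y ∂u = 0` to top order. If `y` is even, an
-- Euler operator argument in characteristic zero lowers the degree of `u`; if `y` is odd,
-- multiplying by `y` and using `y² = 0` lowers the degree of `y u`. Eliminating letters in
-- decreasing order leaves words in the invariants plus a Whittaker vector of lower degree, and
-- induction on the degree gives generation and surjectivity together. Only spanning sets and
-- operators on `Q_χ` are used, so no PBW theorem is needed.

-- Supercommutation relations with the matrix powers

/-- The basis element `e_{ij}` (for `p = 0`) or `f_{ij}` (for `p = 1`) of `Q(n)`. -/
def gen {n : ℕ} (p : Fin 2) (i j : Fin n) : queer n := if p = 0 then e i j else f i j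

/-- The element `e_{ij}^{(m)}` (for `p = 0`) or `f_{ij}^{(m)}` (for `p = 1`) of `U(Q(n))`. -/
def power {n : ℕ} (m : ℕ) (p : Fin 2) (i j : Fin n) : Env n :=
  if p = 0 then eElt m i j else fElt m i j

theorem queerEven_gen {n : ℕ} (p : Fin 2) (i j : Fin n) :
    queerEven n (gen p i j) = if p = 0 then gen p i j else 0 := by
  have h : block (0 : Matrix (Fin n) (Fin n) ℂ) 0 = 0 := Subtype.ext (by simp [block])
  fin_cases p <;> simp [gen, e, f, h]

theorem queerOdd_gen {n : ℕ} (p : Fin 2) (i j : Fin n) :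
    queerOdd n (gen p i j) = if p = 0 then 0 else gen p i j := by
  have h : block (0 : Matrix (Fin n) (Fin n) ℂ) 0 = 0 := Subtype.ext (by simp [block])
  fin_cases p <;> simp [gen, e, f, h]

theorem gen_mem_queerParity {n : ℕ} (p : Fin 2) (i j : Fin n) :
    gen p i j ∈ queerParity n p := by
  fin_cases p
  · exact ⟨gen 0 i j, by simp [queerEven_gen]⟩
  · exact ⟨gen 1 i j, by simp [queerOdd_gen]⟩

theorem gen_bracket {n : ℕ} (p q : Fin 2) (i j k l : Fin n) :
    ⁅gen p i j, gen q k l⁆ = (if j = k then gen (p + q) i l else 0) -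
      (-1 : ℂ) ^ ((p : ℕ) * (q : ℕ)) • (if i = l then gen (p + q) k j else 0) := by
  have h0 : (0 : queer n) = block 0 0 := Subtype.ext (by simp [block])
  have hm : ∀ a b c d : Fin n, Matrix.single a b (1 : ℂ) * Matrix.single c d 1 =
      if b = c then Matrix.single a d 1 else 0 := by
    intro a b c d
    split_ifs with h
    · subst h; simp
    · rw [Matrix.single_mul_single_of_ne _ _ _ _ h]
  have h11 : (1 + 1 : Fin 2) = 0 := rfl
  fin_cases p <;> fin_cases q <;>
    simp [gen, e, f, block_bracket, hm, h0, h11, eq_comm (a := l)] <;> split_ifs <;>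
    simp [block_add, sub_eq_add_neg, block_neg, block_smul] <;> exact h0.symm

theorem gen_mul_gen {n : ℕ} (p q : Fin 2) (i j k l : Fin n) :
    ι n (gen p i j) * ι n (gen q k l) =
      (-1 : ℂ) ^ ((p : ℕ) * (q : ℕ)) • (ι n (gen q k l) * ι n (gen p i j)) +
      (if j = k then ι n (gen (p + q) i l) else 0) -
      (-1 : ℂ) ^ ((p : ℕ) * (q : ℕ)) • (if i = l then ι n (gen (p + q) k j) else 0) := by
  have h := ι_superComm p q _ _ (gen_mem_queerParity p i j) (gen_mem_queerParity q k l)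
  rw [sub_eq_iff_eq_add'] at h
  rw [h, gen_bracket, map_sub, map_smul]
  simp only [apply_ite (ι n), map_zero, add_sub_assoc]

theorem power_zero {n : ℕ} (p : Fin 2) (i j : Fin n) :
    power 0 p i j = if p = 0 ∧ i = j then 1 else 0 := by
  fin_cases p <;> simp [power, eElt, fElt]

theorem power_succ {n : ℕ} (m : ℕ) (p : Fin 2) (i j : Fin n) :
    power (m + 1) p i j = ∑ q : Fin 2, (-1 : ℂ) ^ ((q : ℕ) * m) •
      ∑ k, ι n (gen q i k) * power m (p + q) k j := by
  have h11 : (1 + 1 : Fin 2) = 0 := rfl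
  fin_cases p <;> simp [power, eElt, fElt, gen, h11, pow_add]

theorem power_one {n : ℕ} (p : Fin 2) (i j : Fin n) : power 1 p i j = ι n (gen p i j) := by
  have h11 : (1 + 1 : Fin 2) = 0 := rfl
  rw [power_succ]
  fin_cases p <;> simp [power_zero, h11]

/-- One induction step of `gen_mul_power`, for a single parity `r` of the left factor. The third and
fourth terms come from contracting at the summed index `a`; they do not cancel for fixed `r`. -/
theorem gen_mul_sum {n : ℕ} (m : ℕ) (p q r : Fin 2) (i j k l : Fin n)
    (ih : ∀ a : Fin n, ι n (gen p i j) * power m q a l =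
      (-1 : ℂ) ^ ((p : ℕ) * (q : ℕ)) • (power m q a l * ι n (gen p i j)) +
      (-1 : ℂ) ^ ((p : ℕ) * (m + 1)) • (if j = a then power m (p + q) i l else 0) -
      (-1 : ℂ) ^ ((p : ℕ) * (q : ℕ)) • (if i = l then power m (p + q) a j else 0)) :
    ι n (gen p i j) * ∑ a, ι n (gen r k a) * power m q a l =
      (-1 : ℂ) ^ ((p : ℕ) * (r : ℕ)) • (-1 : ℂ) ^ ((p : ℕ) * (q : ℕ)) •
        ((∑ a, ι n (gen r k a) * power m q a l) * ι n (gen p i j)) +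
      (if j = k then ∑ a, ι n (gen (p + r) i a) * power m q a l else 0) -
      (-1 : ℂ) ^ ((p : ℕ) * (r : ℕ)) • (ι n (gen (p + r) k j) * power m q i l) +
      (-1 : ℂ) ^ ((p : ℕ) * (r : ℕ)) • (-1 : ℂ) ^ ((p : ℕ) * (m + 1)) •
        (ι n (gen r k j) * power m (p + q) i l) -
      (-1 : ℂ) ^ ((p : ℕ) * (r : ℕ)) • (-1 : ℂ) ^ ((p : ℕ) * (q : ℕ)) •
        (if i = l then ∑ a, ι n (gen r k a) * power m (p + q) a j else 0) := by
  have step : ∀ a : Fin n, ι n (gen p i j) * (ι n (gen r k a) * power m q a l) =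
      (-1 : ℂ) ^ ((p : ℕ) * (r : ℕ)) • (-1 : ℂ) ^ ((p : ℕ) * (q : ℕ)) •
        ((ι n (gen r k a) * power m q a l) * ι n (gen p i j)) +
      (if j = k then ι n (gen (p + r) i a) * power m q a l else 0) -
      (-1 : ℂ) ^ ((p : ℕ) * (r : ℕ)) •
        (if i = a then ι n (gen (p + r) k j) * power m q a l else 0) +
      (-1 : ℂ) ^ ((p : ℕ) * (r : ℕ)) • (-1 : ℂ) ^ ((p : ℕ) * (m + 1)) •
        (if j = a then ι n (gen r k a) * power m (p + q) i l else 0) -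
      (-1 : ℂ) ^ ((p : ℕ) * (r : ℕ)) • (-1 : ℂ) ^ ((p : ℕ) * (q : ℕ)) •
        (if i = l then ι n (gen r k a) * power m (p + q) a j else 0) := by
    intro a
    rw [← mul_assoc, gen_mul_gen, sub_mul, add_mul, smul_mul_assoc, smul_mul_assoc, mul_assoc, ih a]
    simp only [mul_sub, mul_add, mul_smul_comm, ite_mul, mul_ite, zero_mul, mul_zero, mul_assoc]
    module
  simp only [Finset.mul_sum, step, Finset.sum_add_distrib, Finset.sum_sub_distrib,
    ← Finset.smul_sum, Finset.sum_mul, Finset.sum_ite_eq, Finset.mem_univ, if_true]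
  congr 2
  · congr 2
    split_ifs <;> simp
  · split_ifs <;> simp

/-- The supercommutation relations between the generators of `Q(n)` and the elements
`e_{ij}^{(m)}`, `f_{ij}^{(m)}`. -/
theorem gen_mul_power {n : ℕ} (m : ℕ) (p q : Fin 2) (i j k l : Fin n) :
    ι n (gen p i j) * power m q k l =
      (-1 : ℂ) ^ ((p : ℕ) * (q : ℕ)) • (power m q k l * ι n (gen p i j)) +
      (-1 : ℂ) ^ ((p : ℕ) * (m + 1)) • (if j = k then power m (p + q) i l else 0) -
      (-1 : ℂ) ^ ((p : ℕ) * (q : ℕ)) • (if i = l then power m (p + q) k j else 0) := by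
  have h11 : (1 + 1 : Fin 2) = 0 := rfl
  induction m generalizing q k with
  | zero =>
    fin_cases p <;> fin_cases q <;> simp [power_zero, h11, eq_comm] <;> split_ifs <;> simp_all
  | succ m ih =>
    -- The terms contracted at the inner index cancel between `r` and `r + p`; the alternating sign
    -- in the recursion for the powers is what makes this work.
    have key := fun r : Fin 2 => gen_mul_sum m p (q + r) r i j k l (fun a => ih (q + r) a)
    rw [power_succ, Fin.sum_univ_two, mul_add, mul_smul_comm, mul_smul_comm, key 0, key 1]
    simp only [power_succ, Fin.sum_univ_two, add_mul, smul_mul_assoc]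
    have hs : (-1 : ℂ) ^ m * (-1 : ℂ) ^ m = 1 := by rw [← mul_pow]; simp
    have hv : ∀ x : Env n, (-1 : ℂ) ^ m • (-1 : ℂ) ^ m • x = x := fun x => by
      rw [smul_smul, hs, one_smul]
    fin_cases p <;> fin_cases q <;> simp [h11, pow_add] <;> split_ifs <;>
      simp [smul_add, hv, sub_eq_add_neg, smul_neg] <;> try abel

-- The subalgebra `m` and the invariance of the last-row, first-column powers

theorem parity_ι {n : ℕ} (x : queer n) : parity n (ι n x) = ι n (queerEven n x - queerOdd n x) :=
  lift_ι _ _ x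

theorem parity_gen {n : ℕ} (p : Fin 2) (i j : Fin n) :
    parity n (ι n (gen p i j)) = (-1 : ℂ) ^ (p : ℕ) • ι n (gen p i j) := by
  rw [parity_ι, queerEven_gen, queerOdd_gen]
  fin_cases p <;> simp

theorem parity_power {n : ℕ} (m : ℕ) (p : Fin 2) (i j : Fin n) :
    parity n (power m p i j) = (-1 : ℂ) ^ (p : ℕ) • power m p i j := by
  have h11 : (1 + 1 : Fin 2) = 0 := rfl
  induction m generalizing p i with
  | zero => fin_cases p <;> simp [power_zero, apply_ite (parity n)]
  | succ m ih =>
    simp only [power_succ, Fin.sum_univ_two, map_add, map_smul, map_sum, map_mul, parity_gen, ih]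
    fin_cases p <;> simp [h11]

theorem block_eq_sum {n : ℕ} (A B : Matrix (Fin n) (Fin n) ℂ) :
    block A B = ∑ i, ∑ j, (A i j • gen 0 i j + B i j • gen 1 i j) := by
  apply Subtype.ext
  simp only [gen, e, f, block, Submodule.coe_sum, Submodule.coe_add, Submodule.coe_smul]
  ext (a | a) (b | b) <;>
    simp [Matrix.sum_apply, Matrix.single_apply, ite_and, Finset.sum_ite_eq']

theorem lower_of_mem_dynkin {n : ℕ} {s : ℕ} (hs : 1 ≤ s) {A B : Matrix (Fin n) (Fin n) ℂ}
    (h : block A B ∈ dynkin n (-2 * (s : ℤ))) (i j : Fin n) (hij : i ≤ j) :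
    A i j = 0 ∧ B i j = 0 := by
  change ⁅hElt n, _⁆ = _ at h
  rw [hElt, block_bracket, block_smul] at h
  have h2 := Matrix.fromBlocks_inj.1 (congrArg Subtype.val h)
  have key : ∀ x : ℂ, ((n : ℂ) - 1 - 2 * (i : ℕ)) * x - x * ((n : ℂ) - 1 - 2 * (j : ℕ)) =
      -(2 * (s : ℂ)) * x → x = 0 := by
    intro x hx
    have h3 : (((j : ℕ) + s - (i : ℕ) : ℤ) : ℂ) * x = 0 := by
      push_cast
      linear_combination hx / 2
    rcases mul_eq_zero.1 h3 with h4 | h4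
    · have h5 : ((j : ℕ) + s - (i : ℕ) : ℤ) = 0 := by exact_mod_cast h4
      have : (i : ℕ) ≤ j := hij
      omega
    · exact h4
  have hA := congrFun (congrFun h2.1 i) j
  have hB := congrFun (congrFun h2.2.1 i) j
  simp at hA hB
  exact ⟨key _ (by simpa using hA), key _ (by simpa using hB)⟩

/-- `ad h` multiplies entry `(i, j)` by `2(j - i)`, so only strictly lower triangular entries have a
negative eigenvalue. -/
theorem nilM_le_span (n : ℕ) :
    nilM n ≤ Submodule.span ℂ {x | ∃ (p : Fin 2) (i j : Fin n), j < i ∧ x = gen p i j} := by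
  refine iSup₂_le fun s hs x hx => ?_
  obtain ⟨A, B, rfl⟩ := exists_block x
  rw [block_eq_sum]
  refine Submodule.sum_mem _ fun i _ => Submodule.sum_mem _ fun j _ => ?_
  by_cases hij : i ≤ j
  · obtain ⟨hA, hB⟩ := lower_of_mem_dynkin (Finset.mem_Icc.1 hs).1 hx i j hij
    simp [hA, hB]
  · rw [not_le] at hij
    exact add_mem (Submodule.smul_mem _ _ (Submodule.subset_span ⟨0, i, j, hij, rfl⟩))
      (Submodule.smul_mem _ _ (Submodule.subset_span ⟨1, i, j, hij, rfl⟩))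

theorem gen_mem_nilM {n : ℕ} (p : Fin 2) {i j : Fin n} (hij : j < i) : gen p i j ∈ nilM n := by
  have hlt : (j : ℕ) < i := hij
  have hi := i.2
  refine Submodule.mem_iSup_of_mem ((i : ℕ) - j) (Submodule.mem_iSup_of_mem
    (Finset.mem_Icc.2 ⟨by omega, by omega⟩) ?_)
  change ⁅hElt n, _⁆ = _
  have hc : (((-2 * (((i : ℕ) - (j : ℕ) : ℕ) : ℤ) : ℤ)) : ℂ) = -2 * ((i : ℕ) - (j : ℕ)) := by
    push_cast [Nat.cast_sub hlt.le]
    ring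
  rw [hc]
  have hd : ∀ g : Fin n → ℂ, Matrix.diagonal g * Matrix.single i j (1 : ℂ) -
      Matrix.single i j 1 * Matrix.diagonal g = (g i - g j) • Matrix.single i j 1 := by
    intro g
    ext a b
    simp only [Matrix.sub_apply, Matrix.diagonal_mul, Matrix.mul_diagonal, Matrix.smul_apply,
      Matrix.single_apply, smul_eq_mul]
    split_ifs with h
    · rw [h.1, h.2]; ring
    · simp
  fin_cases p <;> simp [gen, e, f, hElt, block_bracket, block_smul, hd] <;> congr 1 <;> ext a b <;>
    simp [Matrix.single_apply] <;> split_ifs <;> ring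

theorem chi_gen {n : ℕ} (p : Fin 2) (i j : Fin n) :
    chi n (gen p i j) = if p = 0 ∧ (i : ℕ) = j + 1 then 1 else 0 := by
  change otr ((gen p i j : BlockMat n) * (EElt n : BlockMat n)) = _
  rw [EElt_eq]
  fin_cases p
  · simp [gen, e, block, otr, Matrix.fromBlocks_multiply, Matrix.trace, Matrix.mul_apply,
      Matrix.single_apply]
    rw [Finset.sum_eq_single i, Finset.sum_eq_single j] <;> simp +contextual [eq_comm]
  · simp [gen, f, block, otr, Matrix.fromBlocks_multiply]

/-- For `j < i` neither `j` is the last index nor `i` the first, so both Kronecker deltas in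
`gen_mul_power` vanish. -/
theorem power_mem_adInvariants {n : ℕ} (m : ℕ) (p : Fin 2) {k l : Fin n} (hk : (k : ℕ) = n - 1)
    (hl : (l : ℕ) = 0) : power m p k l ∈ adInvariants n := by
  intro a ha
  have h := nilM_le_span n ha
  clear ha
  induction h using Submodule.span_induction with
  | zero => simp [adAction]
  | add x y _ _ hx hy =>
    have h2 : adAction (x + y) (power m p k l) =
        adAction x (power m p k l) + adAction y (power m p k l) := by
      simp only [adAction, map_add, mul_add, add_mul]
      abel
    rw [h2, hx, hy, add_zero]
  | smul c x _ hx =>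
    have h2 : adAction (c • x) (power m p k l) = c • adAction x (power m p k l) := by
      simp only [adAction, map_smul, mul_smul_comm, smul_mul_assoc, smul_sub]
    rw [h2, hx, smul_zero]
  | mem x hx =>
    obtain ⟨q, i, j, hij, rfl⟩ := hx
    have hlt : (j : ℕ) < i := hij
    have hi := i.2
    have h1 : j ≠ k := fun h => by subst h; omega
    have h2 : i ≠ l := fun h => by subst h; omega
    rw [adAction, gen_mul_power, queerEven_gen, queerOdd_gen, parity_power, if_neg h1, if_neg h2]
    fin_cases q <;> simp

-- The Kazhdan filtration of `Q_χ`

/-- `IsWord z S d v` says that `v` is obtained from `π(1)` by applying elements `z p i j` with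
`i ≤ j` and `S p i j`, where the element `z p i j` is given degree `j - i + 1` and the total degree
is at most `d`. -/
inductive IsWord {n : ℕ} (z : Fin 2 → Fin n → Fin n → Env n) (S : Fin 2 → Fin n → Fin n → Prop) :
    ℤ → WhittakerModule n → Prop
  | one {d : ℤ} (hd : 0 ≤ d) : IsWord z S d (proj n 1)
  | cons {d : ℤ} {v : WhittakerModule n} (p : Fin 2) (i j : Fin n) (hij : i ≤ j) (hS : S p i j)
      (hv : IsWord z S (d - ((j : ℤ) - i + 1)) v) : IsWord z S d (z p i j • v)

/-- The span of the words of degree at most `d`. -/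
def wordSpan {n : ℕ} (z : Fin 2 → Fin n → Fin n → Env n) (S : Fin 2 → Fin n → Fin n → Prop)
    (d : ℤ) : Submodule ℂ (WhittakerModule n) :=
  Submodule.span ℂ {v | IsWord z S d v}

/-- The Kazhdan filtration of `Q_χ`. -/
def kazhdan (n : ℕ) (d : ℤ) : Submodule ℂ (WhittakerModule n) :=
  wordSpan (fun p i j => ι n (gen p i j)) (fun _ _ _ => True) d

/-- Left multiplication on `Q_χ`, as a complex linear map. -/
def leftMul {n : ℕ} (u : Env n) : WhittakerModule n →ₗ[ℂ] WhittakerModule n :=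
  Algebra.lsmul ℂ ℂ (WhittakerModule n) u

@[simp] theorem leftMul_apply {n : ℕ} (u : Env n) (v : WhittakerModule n) :
    leftMul u v = u • v := rfl

section wordSpan

variable {n : ℕ} {z : Fin 2 → Fin n → Fin n → Env n} {S S' : Fin 2 → Fin n → Fin n → Prop}

theorem IsWord.mono {d d' : ℤ} (hd : d ≤ d') (hS : ∀ p i j, S p i j → S' p i j)
    {v : WhittakerModule n} (hv : IsWord z S d v) : IsWord z S' d' v := by
  induction hv generalizing d' with
  | one h => exact .one (h.trans hd)
  | cons p i j hij h _ ih => exact .cons p i j hij (hS _ _ _ h) (ih (by omega))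

theorem wordSpan_mono {d d' : ℤ} (hd : d ≤ d') (hS : ∀ p i j, S p i j → S' p i j) :
    wordSpan z S d ≤ wordSpan z S' d' :=
  Submodule.span_mono fun _ hv => IsWord.mono hd hS hv

theorem map_mem_of_word {d : ℤ} {g : WhittakerModule n →ₗ[ℂ] WhittakerModule n}
    {N : Submodule ℂ (WhittakerModule n)} (h : ∀ v, IsWord z S d v → g v ∈ N)
    {v : WhittakerModule n} (hv : v ∈ wordSpan z S d) : g v ∈ N :=
  (Submodule.span_le (p := N.comap g)).2 h hv

theorem smul_mem_wordSpan {d : ℤ} {p : Fin 2} {i j : Fin n} (hij : i ≤ j) (hS : S p i j)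
    {v : WhittakerModule n} (hv : v ∈ wordSpan z S (d - ((j : ℤ) - i + 1))) :
    z p i j • v ∈ wordSpan z S d :=
  map_mem_of_word (g := leftMul (z p i j))
    (fun _ hw => Submodule.subset_span (.cons p i j hij hS hw)) hv

/-- Letters have `i ≤ j`, hence positive degree. This is the base of every induction on the degree.
-/
theorem wordSpan_neg {d : ℤ} (hd : d < 0) : wordSpan z S d = ⊥ := by
  have h : ∀ (d : ℤ) (v : WhittakerModule n), IsWord z S d v → 0 ≤ d := by
    intro d v hv
    induction hv with
    | one h => exact h
    | cons p i j hij _ _ ih =>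
      have : (i : ℕ) ≤ j := hij
      omega
  rw [wordSpan, Submodule.span_eq_bot]
  intro v hv
  exact absurd (h d v hv) (by omega)

end wordSpan

theorem kazhdan_mono {n : ℕ} {d d' : ℤ} (h : d ≤ d') : kazhdan n d ≤ kazhdan n d' :=
  wordSpan_mono h fun _ _ _ h => h

theorem smul_proj_gen {n : ℕ} (p : Fin 2) {i j : Fin n} (hij : j < i) :
    ι n (gen p i j) • proj n 1 = chi n (gen p i j) • proj n 1 :=
  proj_gen _ (gen_mem_nilM p hij)

theorem gen_smul_power_smul {n : ℕ} (m : ℕ) (p q : Fin 2) (i j k l : Fin n)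
    (v : WhittakerModule n) :
    ι n (gen p i j) • power m q k l • v =
      (-1 : ℂ) ^ ((p : ℕ) * (q : ℕ)) • power m q k l • ι n (gen p i j) • v +
      (-1 : ℂ) ^ ((p : ℕ) * (m + 1)) • (if j = k then power m (p + q) i l • v else 0) -
      (-1 : ℂ) ^ ((p : ℕ) * (q : ℕ)) • (if i = l then power m (p + q) k j • v else 0) := by
  rw [smul_smul, gen_mul_power, sub_smul, add_smul, smul_assoc, smul_assoc, smul_assoc, mul_smul]
  simp only [ite_smul, zero_smul]

/-- The operator `a - χ(a)` on `Q_χ`, where `a` is a basis element of `Q(n)`. -/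
def nilOp {n : ℕ} (p : Fin 2) (i j : Fin n) : WhittakerModule n →ₗ[ℂ] WhittakerModule n :=
  leftMul (ι n (gen p i j)) - chi n (gen p i j) • LinearMap.id

theorem nilOp_apply {n : ℕ} (p : Fin 2) (i j : Fin n) (v : WhittakerModule n) :
    nilOp p i j v = ι n (gen p i j) • v - chi n (gen p i j) • v := rfl

theorem nilOp_power_smul {n : ℕ} (m : ℕ) (p q : Fin 2) (i j k l : Fin n)
    (v : WhittakerModule n) :
    nilOp p i j (power m q k l • v) =
      (-1 : ℂ) ^ ((p : ℕ) * (q : ℕ)) • power m q k l • nilOp p i j v +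
      (-1 : ℂ) ^ ((p : ℕ) * (m + 1)) • (if j = k then power m (p + q) i l • v else 0) -
      (-1 : ℂ) ^ ((p : ℕ) * (q : ℕ)) • (if i = l then power m (p + q) k j • v else 0) := by
  -- The sign is harmless because `χ` vanishes on odd elements: either `p = 0` or the scalar is
  -- zero.
  have hs : (-1 : ℂ) ^ ((p : ℕ) * (q : ℕ)) • power m q k l • chi n (gen p i j) • v =
      chi n (gen p i j) • power m q k l • v := by
    rw [smul_comm (power m q k l) (chi n (gen p i j)), chi_gen]
    split_ifs with h <;> simp [h]
  rw [nilOp_apply, nilOp_apply, gen_smul_power_smul, smul_sub, smul_sub, hs]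
  abel

theorem nilOp_gen_smul {n : ℕ} (p q : Fin 2) (i j k l : Fin n) (v : WhittakerModule n) :
    nilOp p i j (ι n (gen q k l) • v) =
      (-1 : ℂ) ^ ((p : ℕ) * (q : ℕ)) • ι n (gen q k l) • nilOp p i j v +
      (if j = k then ι n (gen (p + q) i l) • v else 0) -
      (-1 : ℂ) ^ ((p : ℕ) * (q : ℕ)) • (if i = l then ι n (gen (p + q) k j) • v else 0) := by
  have h := nilOp_power_smul 1 p q i j k l v
  simp only [power_one] at h
  rw [h, mul_comm (p : ℕ), pow_mul]
  norm_num

/-- The operator `a - χ(a)` kills `π(1)` and passes each letter at the cost of a supercommutator,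
whose degree is one less than that of the product. -/
theorem nilOp_word {n : ℕ} {d : ℤ} {v : WhittakerModule n}
    (hv : IsWord (fun p i j => ι n (gen p i j)) (fun _ _ _ => True) d v) :
    ∀ (p : Fin 2) (i j : Fin n), j < i →
      nilOp p i j v ∈ kazhdan n (d + j - i) := by
  induction hv with
  | one h =>
    intro p i j hij
    rw [nilOp_apply, smul_proj_gen p hij, sub_self]
    exact zero_mem _
  | @cons d u q k l hkl hS hu ih =>
    have hu' : u ∈ kazhdan n (d - ((l : ℤ) - k + 1)) := Submodule.subset_span hu
    -- A contraction may land below the diagonal, where it is not a letter; there the induction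
    -- hypothesis on the shorter word `u` bounds it.
    have low : ∀ (p : Fin 2) (i j : Fin n),
        ι n (gen p i j) • u ∈ kazhdan n (d - ((l : ℤ) - k + 1) + j - i + 1) := by
      intro p i j
      rcases le_or_gt i j with hij | hij
      · refine smul_mem_wordSpan (z := fun p i j => ι n (gen p i j)) hij trivial ?_
        exact kazhdan_mono (by omega) hu'
      · rw [← sub_add_cancel (ι n (gen p i j) • u) (chi n (gen p i j) • u)]
        refine add_mem (kazhdan_mono (by omega) (ih p i j hij)) ?_
        rw [chi_gen]
        split_ifs with h
        · rw [one_smul]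
          exact kazhdan_mono (by omega) hu'
        · rw [zero_smul]
          exact zero_mem _
    intro p i j hij
    rw [nilOp_gen_smul]
    refine sub_mem (add_mem (Submodule.smul_mem _ _ ?_) ?_) (Submodule.smul_mem _ _ ?_)
    · refine smul_mem_wordSpan (z := fun p i j => ι n (gen p i j)) hkl trivial ?_
      exact kazhdan_mono (by omega) (ih p i j hij)
    · split_ifs with h
      · subst h
        exact kazhdan_mono (by omega) (low _ _ _)
      · exact zero_mem _
    · split_ifs with h
      · subst h
        exact kazhdan_mono (by omega) (low _ _ _)
      · exact zero_mem _

theorem nilOp_mem {n : ℕ} {d : ℤ} {v : WhittakerModule n} (hv : v ∈ kazhdan n d)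
    (p : Fin 2) {i j : Fin n} (hij : j < i) :
    nilOp p i j v ∈ kazhdan n (d + j - i) :=
  map_mem_of_word (fun _ hw => nilOp_word hw p i j hij) hv

theorem gen_smul_mem {n : ℕ} {d : ℤ} {v : WhittakerModule n} (hv : v ∈ kazhdan n d)
    (p : Fin 2) (i j : Fin n) : ι n (gen p i j) • v ∈ kazhdan n (d + j - i + 1) := by
  rcases le_or_gt i j with hij | hij
  · refine smul_mem_wordSpan (z := fun p i j => ι n (gen p i j)) hij trivial ?_
    exact kazhdan_mono (by omega) hv
  · rw [← sub_add_cancel (ι n (gen p i j) • v) (chi n (gen p i j) • v)]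
    refine add_mem (kazhdan_mono (by omega) (nilOp_mem hv p hij)) ?_
    rw [chi_gen]
    split_ifs with h
    · rw [one_smul]
      exact kazhdan_mono (by omega) hv
    · rw [zero_smul]
      exact zero_mem _

/-- The elements of `m` on which `χ` vanishes lower the Kazhdan degree by one more than expected. -/
theorem gen_smul_mem_of_chi_eq_zero {n : ℕ} {d : ℤ} {v : WhittakerModule n} (hv : v ∈ kazhdan n d)
    (p : Fin 2) {i j : Fin n} (hij : j < i) (h : ¬ (p = 0 ∧ (i : ℕ) = j + 1)) :
    ι n (gen p i j) • v ∈ kazhdan n (d + j - i) := by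
  have h1 := nilOp_mem hv p hij
  rwa [nilOp_apply, chi_gen, if_neg h, zero_smul, sub_zero] at h1

theorem gen_sub_self_mem {n : ℕ} {d : ℤ} {v : WhittakerModule n} (hv : v ∈ kazhdan n d)
    {i j : Fin n} (h : (i : ℕ) = j + 1) : ι n (gen 0 i j) • v - v ∈ kazhdan n (d - 1) := by
  have h1 := nilOp_mem hv 0 (i := i) (j := j) (by rw [Fin.lt_def]; omega)
  rw [nilOp_apply, chi_gen, if_pos ⟨rfl, h⟩, one_smul] at h1
  exact kazhdan_mono (by omega) h1

-- Action of the matrix powers on the filtration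

theorem power_succ_smul {n : ℕ} (m : ℕ) (p : Fin 2) (i j : Fin n) (v : WhittakerModule n) :
    power (m + 1) p i j • v = ∑ q : Fin 2, ∑ k, (-1 : ℂ) ^ ((q : ℕ) * m) •
      (ι n (gen q i k) • power m (p + q) k j • v) := by
  simp only [power_succ, Finset.sum_smul, smul_assoc, mul_smul, Finset.smul_sum]

theorem power_smul_mem {n : ℕ} {d : ℤ} {v : WhittakerModule n} (hv : v ∈ kazhdan n d)
    (m : ℕ) (p : Fin 2) (i j : Fin n) : power m p i j • v ∈ kazhdan n (d + j - i + m) := by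
  induction m generalizing p i with
  | zero =>
    rw [power_zero]
    split_ifs with h
    · rw [one_smul, h.2]
      exact kazhdan_mono (by omega) hv
    · rw [zero_smul]
      exact zero_mem _
  | succ m ih =>
    rw [power_succ_smul]
    refine Submodule.sum_mem _ fun q _ => Submodule.sum_mem _ fun k _ => Submodule.smul_mem _ _ ?_
    exact kazhdan_mono (by push_cast; omega) (gen_smul_mem (ih (p + q) k) q i k)

/-- Supercommutativity of the graded action: the contracted terms have degree one less than the
product. -/
theorem gen_power_supercomm_mem {n : ℕ} {d : ℤ} {v : WhittakerModule n} (hv : v ∈ kazhdan n d)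
    (m : ℕ) (p q : Fin 2) (i j k l : Fin n) :
    ι n (gen p i j) • power m q k l • v -
      (-1 : ℂ) ^ ((p : ℕ) * (q : ℕ)) • power m q k l • ι n (gen p i j) • v ∈
        kazhdan n (d + (j - i) + (l - k + m)) := by
  rw [gen_smul_power_smul, add_sub_assoc, add_sub_cancel_left]
  refine sub_mem (Submodule.smul_mem _ _ ?_) (Submodule.smul_mem _ _ ?_)
  · split_ifs with h
    · subst h
      exact kazhdan_mono (by omega) (power_smul_mem hv m (p + q) i l)
    · exact zero_mem _
  · split_ifs with h
    · subst h
      exact kazhdan_mono (by omega) (power_smul_mem hv m (p + q) k j)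
    · exact zero_mem _

theorem Env.induction {n : ℕ} {C : Env n → Prop} (algebraMap : ∀ r, C (algebraMap ℂ (Env n) r))
    (ι : ∀ x, C (ι n x)) (mul : ∀ a b, C a → C b → C (a * b)) (add : ∀ a b, C a → C b → C (a + b))
    (u : Env n) : C u := by
  obtain ⟨a, rfl⟩ := RingQuot.mkAlgHom_surjective ℂ (EnvRel n) u
  induction a using TensorAlgebra.induction with
  | algebraMap r => rw [AlgHom.commutes]; exact algebraMap r
  | ι x => exact ι x
  | mul a b ha hb => rw [map_mul]; exact mul _ _ ha hb
  | add a b ha hb => rw [map_add]; exact add _ _ ha hb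

theorem exists_mem_kazhdan {n : ℕ} (v : WhittakerModule n) : ∃ d : ℕ, v ∈ kazhdan n d := by
  obtain ⟨u, rfl⟩ := proj_surjective n v
  have h1 : proj n u = u • proj n 1 := by rw [← map_smul, smul_eq_mul, mul_one]
  have key : ∀ (d : ℤ) (w : WhittakerModule n), w ∈ kazhdan n d →
      ∃ d' : ℤ, u • w ∈ kazhdan n d' := by
    clear h1
    induction u using Env.induction with
    | algebraMap r =>
      intro d w hw
      refine ⟨d, ?_⟩
      rw [algebraMap_smul]
      exact (kazhdan n d).smul_mem r hw
    | ι x =>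
      intro d w hw
      refine ⟨d + n + 1, ?_⟩
      obtain ⟨A, B, rfl⟩ := exists_block x
      rw [block_eq_sum]
      simp only [map_sum, map_add, map_smul, Finset.sum_smul, add_smul, smul_assoc]
      have hg : ∀ (p : Fin 2) (i j : Fin n), ι n (gen p i j) • w ∈ kazhdan n (d + n + 1) :=
        fun p i j => kazhdan_mono (by omega) (gen_smul_mem hw p i j)
      exact Submodule.sum_mem _ fun i _ => Submodule.sum_mem _ fun j _ =>
        add_mem (Submodule.smul_mem _ _ (hg _ _ _)) (Submodule.smul_mem _ _ (hg _ _ _))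
    | mul a b ha hb =>
      intro d w hw
      obtain ⟨d', h'⟩ := hb d w hw
      obtain ⟨d'', h''⟩ := ha d' _ h'
      exact ⟨d'', by rwa [mul_smul]⟩
    | add a b ha hb =>
      intro d w hw
      obtain ⟨d', h'⟩ := hb d w hw
      obtain ⟨d'', h''⟩ := ha d _ hw
      refine ⟨max d' d'', ?_⟩
      rw [add_smul]
      exact add_mem (kazhdan_mono (le_max_right _ _) h'') (kazhdan_mono (le_max_left _ _) h')
  obtain ⟨d, hd⟩ := key 0 (proj n 1) (Submodule.subset_span (.one le_rfl))
  rw [h1]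
  exact ⟨d.toNat, kazhdan_mono (Int.self_le_toNat d) hd⟩

-- Leading terms of the matrix powers in the first column

/-- Isolates the one summand of a matrix product that carries the leading term `x`. -/
theorem sum_sub_mem {n : ℕ} {N : Submodule ℂ (WhittakerModule n)} {x : WhittakerModule n}
    (t : Fin 2 → Fin n → WhittakerModule n) (q₀ : Fin 2) (k₀ : Fin n) (h₀ : t q₀ k₀ - x ∈ N)
    (h : ∀ q k, ¬ (q = q₀ ∧ k = k₀) → t q k ∈ N) : ∑ q, ∑ k, t q k - x ∈ N := by
  have h1 : ∑ q, ∑ k, t q k - x =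
      ∑ q, ∑ k, (if q = q₀ ∧ k = k₀ then t q k - x else t q k) := by
    have h2 : ∀ q k, (if q = q₀ ∧ k = k₀ then t q k - x else t q k) =
        t q k - if q = q₀ then (if k = k₀ then x else 0) else 0 := by
      intro q k
      split_ifs <;> simp_all
    simp only [h2, Finset.sum_sub_distrib]
    congr 1
    rw [Finset.sum_eq_single q₀] <;> simp +contextual
  rw [h1]
  refine Submodule.sum_mem _ fun q _ => Submodule.sum_mem _ fun k _ => ?_
  split_ifs with hqk
  · rw [hqk.1, hqk.2]; exact h₀
  · exact h q k hqk

/-- `e_{i1}^{(m)}` and `f_{i1}^{(m)}` (with `i` counted from `0`) lower the Kazhdan degree by one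
more than expected if `m < i`; for `m = i` they act as the identity, respectively as zero, up to
terms of lower degree. -/
theorem power_smul_mem_of_le {n : ℕ} (m : ℕ) : ∀ (p : Fin 2) (i l : Fin n) (d : ℤ)
    (v : WhittakerModule n), v ∈ kazhdan n d → (l : ℕ) = 0 →
      (m < i → power m p i l • v ∈ kazhdan n (d + m - i - 1)) ∧
      (m = i → power m p i l • v - (if p = 0 then v else 0) ∈ kazhdan n (d - 1)) := by
  induction m with
  | zero =>
    intro p i l d v hv hl
    rw [power_zero]
    constructor
    · intro hi
      rw [if_neg (by rintro ⟨-, rfl⟩; omega), zero_smul]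
      exact zero_mem _
    · intro hi
      have : i = l := by ext; omega
      split_ifs with h1 h2 h2
      · simp
      · exact absurd h1.1 h2
      · exact absurd ⟨h2, this⟩ h1
      · simp
  | succ m ih =>
    intro p i l d v hv hl
    -- Both bounds gain one degree: for `k > m` the power factor drops by induction, and for `k < i`
    -- the left factor lies in `m` and drops unless it is the even subdiagonal element.
    have big : ∀ (q : Fin 2) (k : Fin n), m < k →
        ι n (gen q i k) • power m (p + q) k l • v ∈ kazhdan n (d + m - i) := fun q k hk =>
      kazhdan_mono (by omega) (gen_smul_mem ((ih (p + q) k l d v hv hl).1 hk) q i k)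
    have small : ∀ (q : Fin 2) (k : Fin n), k < i → ¬ (q = 0 ∧ (i : ℕ) = k + 1) →
        ι n (gen q i k) • power m (p + q) k l • v ∈ kazhdan n (d + m - i) := fun q k hk hqk =>
      kazhdan_mono (by omega)
        (gen_smul_mem_of_chi_eq_zero (power_smul_mem hv m (p + q) k l) q hk hqk)
    rw [power_succ_smul]
    constructor
    · intro hi
      refine Submodule.sum_mem _ fun q _ => Submodule.sum_mem _ fun k _ =>
        Submodule.smul_mem _ _ ?_
      rcases lt_or_ge m k with hk | hk
      · exact kazhdan_mono (by push_cast; omega) (big q k hk)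
      · exact kazhdan_mono (by push_cast; omega)
          (small q k (by rw [Fin.lt_def]; omega) (by omega))
    · intro hi
      have hin := i.2
      refine sum_sub_mem _ 0 ⟨m, by omega⟩ ?_ ?_
      · have h1 := (ih p ⟨m, by omega⟩ l d v hv hl).2 rfl
        have h2 := gen_sub_self_mem (power_smul_mem hv m p ⟨m, by omega⟩ l)
          (i := i) (j := ⟨m, by omega⟩) (by simp; omega)
        have h3 := add_mem (kazhdan_mono (d' := d - 1) (by simp; omega) h2) h1
        simpa using h3
      · intro q k hqk
        refine Submodule.smul_mem _ _ ?_
        rcases lt_or_ge m k with hk | hk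
        · exact kazhdan_mono (by omega) (big q k hk)
        · refine kazhdan_mono (by omega) (small q k (by rw [Fin.lt_def]; omega) ?_)
          rintro ⟨rfl, h⟩
          exact hqk ⟨rfl, by ext; simp; omega⟩

/-- The span of the products, of degree at most `d`, whose first factor is a basis element of degree
less than `s`, or of degree `s` and outside the last column, together with everything of degree less
than `d`. -/
def decomposable (n : ℕ) (s d : ℤ) : Submodule ℂ (WhittakerModule n) :=
  Submodule.span ℂ {v | ∃ (q : Fin 2) (k b : Fin n) (u : WhittakerModule n), k ≤ b ∧
    ((b : ℤ) - k + 1 < s ∨ ((b : ℤ) - k + 1 = s ∧ (b : ℕ) + 1 < n)) ∧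
    u ∈ kazhdan n (d - ((b : ℤ) - k + 1)) ∧ v = ι n (gen q k b) • u} ⊔ kazhdan n (d - 1)

theorem decomposable_le (n : ℕ) (s d : ℤ) : decomposable n s d ≤ kazhdan n d := by
  refine sup_le (Submodule.span_le.2 ?_) (kazhdan_mono (by omega))
  rintro _ ⟨q, k, b, u, hkb, -, hu, rfl⟩
  exact kazhdan_mono (by omega) (gen_smul_mem hu q k b)

theorem gen_sub_self_mem_decomposable {n : ℕ} {s d : ℤ} {v : WhittakerModule n}
    (hv : v ∈ kazhdan n d) {i j : Fin n} (h : (i : ℕ) = j + 1) :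
    ι n (gen 0 i j) • v - v ∈ decomposable n s d :=
  Submodule.mem_sup_right (gen_sub_self_mem hv h)

theorem gen_smul_mem_decomposable {n : ℕ} {s d : ℤ} {v : WhittakerModule n}
    (hv : v ∈ decomposable n s d) {i j : Fin n} (h : (i : ℕ) = j + 1) :
    ι n (gen 0 i j) • v ∈ decomposable n s d := by
  rw [← sub_add_cancel (ι n (gen 0 i j) • v) v]
  exact add_mem (gen_sub_self_mem_decomposable (decomposable_le n s d hv) h) hv

/-- Terms with `k > m` or `k < i` fall in lower degree. If `i ≤ k ≤ m`, the left factor has degree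
at most `m + 1 - i`, with equality only for `k = m`, and `h2` then keeps it out of the last column.
-/
theorem power_term_mem_decomposable {n : ℕ} (m : ℕ) (p q : Fin 2) (i k l : Fin n) (d : ℤ)
    {v : WhittakerModule n} (hv : v ∈ kazhdan n d) (hl : (l : ℕ) = 0)
    (h1 : ¬ (q = 0 ∧ (i : ℕ) = k + 1)) (h2 : ¬ ((k : ℕ) = m ∧ (k : ℕ) + 1 = n)) :
    ι n (gen q i k) • power m (p + q) k l • v ∈
      decomposable n ((m + 1 : ℕ) - i) (d + (m + 1 : ℕ) - i) := by
  have hk := k.2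
  rcases lt_or_ge m k with hmk | hmk
  · refine Submodule.mem_sup_right (kazhdan_mono (by push_cast; omega)
      (gen_smul_mem ((power_smul_mem_of_le m (p + q) k l d v hv hl).1 hmk) q i k))
  · have h3 := power_smul_mem hv m (p + q) k l
    rcases lt_or_ge k i with hki | hki
    · exact Submodule.mem_sup_right (kazhdan_mono (by push_cast; omega)
        (gen_smul_mem_of_chi_eq_zero h3 q hki h1))
    · refine Submodule.mem_sup_left (Submodule.subset_span
        ⟨q, i, k, _, hki, ?_, kazhdan_mono ?_ h3, rfl⟩)
      · push_cast; omega
      · push_cast; omega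

theorem power_smul_mem_decomposable {n : ℕ} (m : ℕ) : ∀ (p : Fin 2) (i l : Fin n) (d : ℤ)
    (v : WhittakerModule n), v ∈ kazhdan n d → (l : ℕ) = 0 → (i : ℕ) < m → m < n →
      power m p i l • v ∈ decomposable n (m - i) (d + m - i) := by
  induction m with
  | zero => intro p i l d v _ _ h; omega
  | succ m ih =>
    intro p i l d v hv hl him hmn
    rw [power_succ_smul]
    refine Submodule.sum_mem _ fun q _ => Submodule.sum_mem _ fun k _ => Submodule.smul_mem _ _ ?_
    by_cases h1 : q = 0 ∧ (i : ℕ) = k + 1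
    · obtain ⟨rfl, h1⟩ := h1
      refine gen_smul_mem_decomposable ?_ h1
      have h2 := ih (p + 0) k l d v hv hl (by omega) (by omega)
      convert h2 using 2 <;> push_cast <;> omega
    · exact power_term_mem_decomposable m p q i k l d hv hl h1 (by omega)

/-- The leading term of `e_{i1}^{(m)}` and `f_{i1}^{(m)}` in the last column. -/
theorem power_smul_sub_mem_decomposable {n : ℕ} (m : ℕ) : ∀ (p : Fin 2) (i l k₀ b₀ : Fin n) (d : ℤ)
    (v : WhittakerModule n), v ∈ kazhdan n d → (l : ℕ) = 0 → n ≤ m → (k₀ : ℕ) + m = n + i →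
      (b₀ : ℕ) + 1 = n →
      power m p i l • v - (-1 : ℂ) ^ ((p : ℕ) * (n - 1)) • ι n (gen p k₀ b₀) • v ∈
        decomposable n (m - i) (d + m - i) := by
  induction m with
  | zero => intro p i l k₀ b₀ d v _ _ h; have := i.2; omega
  | succ m ih =>
    intro p i l k₀ b₀ d v hv hl hmn hk₀ hb₀
    have hi := i.2
    rw [power_succ_smul]
    rcases hmn.eq_or_lt with hmn | hmn
    · have hbm : (b₀ : ℕ) = m := by omega
      obtain rfl : k₀ = i := by ext; omega
      -- Here `m = n - 1` and the new linear term is born: the last-column element times an even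
      -- power that acts as the identity to top order. The recursion supplies the sign `(-1) ^ (p *
      -- m)`.
      refine sum_sub_mem _ p b₀ ?_ ?_
      · have h1 := (power_smul_mem_of_le m 0 b₀ l d v hv hl).2 hbm.symm
        have h2 := gen_smul_mem h1 p k₀ b₀
        have h3 : p + p = 0 := by fin_cases p <;> rfl
        rw [h3, show n - 1 = m by omega, ← smul_sub, ← smul_sub]
        refine Submodule.smul_mem _ _ (Submodule.mem_sup_right (kazhdan_mono ?_ h2))
        push_cast; omega
      · intro q k hqk
        refine Submodule.smul_mem _ _ ?_
        by_cases h1 : q = 0 ∧ (k₀ : ℕ) = k + 1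
        · obtain ⟨rfl, h1⟩ := h1
          refine gen_smul_mem_decomposable ?_ h1
          have h2 := power_smul_mem_decomposable m (p + 0) k l d v hv hl (by omega) (by omega)
          convert h2 using 2 <;> push_cast <;> omega
        · by_cases h2 : k = b₀
          · subst h2
            have h3 := (power_smul_mem_of_le m (p + q) k l d v hv hl).2 hbm.symm
            have h4 : p + q ≠ 0 := by
              intro h4
              refine hqk ⟨?_, rfl⟩
              fin_cases p <;> fin_cases q <;> simp_all
            rw [if_neg h4, sub_zero] at h3
            refine Submodule.mem_sup_right (kazhdan_mono ?_ (gen_smul_mem h3 q k₀ k))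
            push_cast; omega
          · refine power_term_mem_decomposable m p q k₀ k l d hv hl h1 fun h3 => h2 ?_
            ext; omega
    · have hk₀n := k₀.2
      have hi1 : (i : ℕ) - 1 < n := by omega
      -- Now `m ≥ n`, which forces `i ≥ 1`. The leading term is inherited from row `i - 1` through
      -- the subdiagonal element, which acts as the identity to top order.
      refine sum_sub_mem _ 0 ⟨(i : ℕ) - 1, hi1⟩ ?_ ?_
      · have h1 := ih p ⟨(i : ℕ) - 1, hi1⟩ l k₀ b₀ d v hv hl (by omega) (by simp; omega) hb₀
        have hii : (i : ℕ) = (⟨(i : ℕ) - 1, hi1⟩ : Fin n) + 1 := by simp; omega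
        have h2 := gen_smul_mem_decomposable h1 hii
        have h3 : (-1 : ℂ) ^ ((p : ℕ) * (n - 1)) • ι n (gen p k₀ b₀) • v ∈
            kazhdan n (d + m - ((⟨(i : ℕ) - 1, hi1⟩ : Fin n) : ℕ)) :=
          Submodule.smul_mem _ _ (kazhdan_mono (by simp; omega) (gen_smul_mem hv p k₀ b₀))
        have h4 := add_mem h2 (gen_sub_self_mem_decomposable h3 hii)
        rw [smul_sub, sub_add_sub_cancel] at h4
        simp only [Fin.val_zero, zero_mul, pow_zero, one_smul, add_zero]
        convert h4 using 2 <;> push_cast <;> omega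
      · intro q k hqk
        refine Submodule.smul_mem _ _
          (power_term_mem_decomposable m p q i k l d hv hl ?_ (by omega))
        rintro ⟨rfl, h⟩
        exact hqk ⟨rfl, by ext; simp; omega⟩

-- Replacing the last column by invariants

/-- The basis elements of the upper triangular part of `Q(n)`, with those in the last column replaced
by the invariants `e_{n,1}^{(m)}`, `f_{n,1}^{(m)}` of the same degree. -/
def letter {n : ℕ} (p : Fin 2) (i j : Fin n) : Env n :=
  if (j : ℕ) + 1 = n then power (2 * n - 1 - i) p j ⟨0, i.pos⟩ else ι n (gen p i j)

/-- Both kinds of letter are matrix powers of the same degree as the entry they stand for, so the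
bounds for powers apply uniformly. -/
theorem letter_eq_power {n : ℕ} (p : Fin 2) (i j : Fin n) :
    ∃ (m : ℕ) (k l : Fin n), letter p i j = power m p k l ∧ (l : ℤ) - k + m = j - i + 1 := by
  have hi := i.2
  rw [letter]
  split_ifs with h
  · exact ⟨_, _, _, rfl, by simp; omega⟩
  · exact ⟨1, i, j, (power_one p i j).symm, by simp⟩

theorem letter_smul_mem {n : ℕ} {d : ℤ} {v : WhittakerModule n} (hv : v ∈ kazhdan n d)
    (p : Fin 2) (i j : Fin n) : letter p i j • v ∈ kazhdan n (d + j - i + 1) := by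
  obtain ⟨m, k, l, h, hd⟩ := letter_eq_power p i j
  rw [h]
  exact kazhdan_mono (by omega) (power_smul_mem hv m p k l)

theorem gen_letter_supercomm_mem {n : ℕ} {d : ℤ} {v : WhittakerModule n} (hv : v ∈ kazhdan n d)
    (p q : Fin 2) (i j k l : Fin n) :
    ι n (gen p i j) • letter q k l • v -
      (-1 : ℂ) ^ ((p : ℕ) * (q : ℕ)) • letter q k l • ι n (gen p i j) • v ∈
        kazhdan n (d + (j - i) + (l - k + 1)) := by
  obtain ⟨m, a, b, h, hd⟩ := letter_eq_power q k l
  rw [h]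
  exact kazhdan_mono (by omega) (gen_power_supercomm_mem hv m p q i j a b)

theorem wordSpan_letter_le {n : ℕ} (S : Fin 2 → Fin n → Fin n → Prop) (d : ℤ) :
    wordSpan letter S d ≤ kazhdan n d := by
  refine Submodule.span_le.2 fun v hv => ?_
  induction hv with
  | one hd => exact Submodule.subset_span (.one hd)
  | cons p i j _ _ _ ih => exact kazhdan_mono (by omega) (letter_smul_mem ih p i j)

/-- Triangular substitution. In the last column the element is, up to sign, its letter plus
decomposables. The leading factor of a decomposable has smaller `b - k`, or equal `b - k` outside
the last column; either way `t` drops. Tails have lower degree and are covered by `hd`. -/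
theorem gen_smul_mem_wordSpan_letter {n : ℕ} {d : ℤ}
    (hd : ∀ d' < d, kazhdan n d' ≤ wordSpan letter (fun _ _ _ => True) d') (t : ℕ) :
    ∀ (q : Fin 2) (k b : Fin n) (u : WhittakerModule n), k ≤ b →
      2 * ((b : ℕ) - k) + (if (b : ℕ) + 1 = n then 1 else 0) = t →
      u ∈ kazhdan n (d - ((b : ℤ) - k + 1)) →
      ι n (gen q k b) • u ∈ wordSpan letter (fun _ _ _ => True) d := by
  induction t using Nat.strong_induction_on with
  | _ t ih =>
  intro q k b u hkb ht hu
  have hkb' : (k : ℕ) ≤ b := hkb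
  have hk := k.2
  have hl : letter q k b • u ∈ wordSpan letter (fun _ _ _ => True) d :=
    smul_mem_wordSpan hkb trivial (hd _ (by omega) hu)
  have hlet : letter q k b =
    if (b : ℕ) + 1 = n then power (2 * n - 1 - k) q b ⟨0, k.pos⟩ else ι n (gen q k b) := rfl
  by_cases hb : (b : ℕ) + 1 = n
  · rw [if_pos hb] at hlet ht
    have h1 := power_smul_sub_mem_decomposable (2 * n - 1 - k) q b ⟨0, k.pos⟩ k b _ u hu rfl
      (by omega) (by omega) hb
    rw [← hlet] at h1
    have h2 : decomposable n ((2 * n - 1 - k : ℕ) - b)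
        (d - ((b : ℤ) - k + 1) + (2 * n - 1 - k : ℕ) - b) ≤
          wordSpan letter (fun _ _ _ => True) d := by
      refine sup_le (Submodule.span_le.2 ?_)
        ((hd _ (by omega)).trans (wordSpan_mono (by omega) fun _ _ _ h => h))
      rintro _ ⟨q', k', b', u', hkb', h3, hu', rfl⟩
      have : (k' : ℕ) ≤ b' := hkb'
      refine ih _ ?_ q' k' b' u' hkb' rfl (kazhdan_mono (by omega) hu')
      split_ifs <;> omega
    have h3 := sub_mem hl (h2 h1)
    rw [sub_sub_cancel] at h3
    have h4 := Submodule.smul_mem _ ((-1 : ℂ) ^ ((q : ℕ) * (n - 1))) h3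
    rwa [smul_smul, ← mul_pow, neg_one_mul, neg_neg, one_pow, one_smul] at h4
  · rwa [hlet, if_neg hb] at hl

theorem kazhdan_le_wordSpan_letter {n : ℕ} (N : ℕ) : ∀ d : ℤ, d < N →
    kazhdan n d ≤ wordSpan letter (fun _ _ _ => True) d := by
  induction N with
  | zero =>
    intro d hd
    rw [kazhdan, wordSpan_neg (by simpa using hd)]
    exact bot_le
  | succ N ih =>
    intro d hd
    refine Submodule.span_le.2 fun v hv => ?_
    cases hv with
    | one h => exact Submodule.subset_span (.one h)
    | cons p i j hij _ hu =>
      exact gen_smul_mem_wordSpan_letter (fun d' hd' => ih d' (by push_cast at hd; omega)) _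
        p i j _ hij rfl (Submodule.subset_span hu)

-- Elimination of the letters outside the last column

/-- The order in which the letters outside the last column are eliminated. -/
def rank {n : ℕ} (p : Fin 2) (i j : Fin n) : ℕ := (((j : ℕ) - i) * n + i) * 2 + p

theorem lt_or_eq_of_mul_add_le {n a b x y : ℕ} (h : a * n + x ≤ b * n + y)
    (hy : y < n) : a < b ∨ (a = b ∧ x ≤ y) := by
  rcases lt_trichotomy a b with h1 | h1 | h1
  · exact .inl h1
  · subst h1
    exact .inr ⟨rfl, by omega⟩
  · have h2 : (b + 1) * n ≤ a * n := Nat.mul_le_mul_right n h1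
    rw [add_mul, one_mul] at h2
    omega

/-- Since `i < n` and `p < 2`, the rank encodes the lexicographic order on `(j - i, i, p)`. -/
theorem rank_lt {n : ℕ} {p q : Fin 2} {i j k l : Fin n} (h : rank q k l < rank p i j) :
    (l : ℕ) - k < j - i ∨ ((l : ℕ) - k = j - i ∧ (k : ℕ) < i) ∨
      ((l : ℕ) - k = j - i ∧ k = i ∧ q = 0 ∧ p = 1) := by
  have hp := p.2
  have hq := q.2
  rw [rank, rank] at h
  rcases lt_or_eq_of_mul_add_le (show ((l : ℕ) - k) * n + k ≤ ((j : ℕ) - i) * n + i by omega)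
    i.2 with h1 | ⟨h1, h2⟩
  · exact .inl h1
  · rcases h2.lt_or_eq with h3 | h3
    · exact .inr (.inl ⟨h1, h3⟩)
    · rw [h1, h3] at h
      exact .inr (.inr ⟨h1, by ext; exact h3, by ext; simp; omega, by ext; simp; omega⟩)

theorem eq_of_rank_eq {n : ℕ} {p q : Fin 2} {i j k l : Fin n} (hij : i ≤ j) (hkl : k ≤ l)
    (h : rank q k l = rank p i j) : q = p ∧ k = i ∧ l = j := by
  have hij' : (i : ℕ) ≤ j := hij
  have hkl' : (k : ℕ) ≤ l := hkl
  have hp := p.2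
  have hq := q.2
  rw [rank, rank] at h
  have h1 : ((l : ℕ) - k) * n + k = ((j : ℕ) - i) * n + i := by omega
  have h2 := lt_or_eq_of_mul_add_le h1.le i.2
  have h3 := lt_or_eq_of_mul_add_le h1.ge k.2
  exact ⟨by ext; omega, by ext; omega, by ext; omega⟩

/-- The letters of the last column and those of rank less than `r`. -/
def Remaining {n : ℕ} (r : ℕ) (p : Fin 2) (i j : Fin n) : Prop := (j : ℕ) + 1 = n ∨ rank p i j < r

/-- The dual derivation `∂` of the letter at `(p, i, j)` kills the remaining letters to top order:
it commutes with the invariants up to sign, and its contraction with an earlier letter lies in the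
part of `m` where `χ` vanishes. The order by rank is chosen for this. -/
theorem nilOp_word_mem {n : ℕ} {p : Fin 2} {i j j' : Fin n} (hij : i ≤ j) (hj : (j' : ℕ) = j + 1)
    {d : ℤ} {v : WhittakerModule n} (hv : IsWord letter (Remaining (rank p i j)) d v) :
    nilOp p j' i v ∈ kazhdan n (d - (j - i + 1) - 1) := by
  have hij' : (i : ℕ) ≤ j := hij
  have hj' := j'.2
  induction hv with
  | one h =>
    rw [nilOp_apply, smul_proj_gen p (by rw [Fin.lt_def]; omega), sub_self]
    exact zero_mem _
  | @cons d u q k l hkl hS hu ih =>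
    have hkl' : (k : ℕ) ≤ l := hkl
    have hu' : u ∈ kazhdan n (d - ((l : ℤ) - k + 1)) :=
      wordSpan_letter_le _ _ (Submodule.subset_span hu)
    have h1 := letter_smul_mem ih q k l
    rw [letter] at h1 ⊢
    by_cases hl : (l : ℕ) + 1 = n
    · rw [if_pos hl] at h1 ⊢
      rw [nilOp_power_smul, if_neg (by rintro rfl; omega),
        if_neg (by rintro rfl; simp at hj), smul_zero, smul_zero, add_zero, sub_zero]
      exact Submodule.smul_mem _ _ (kazhdan_mono (by omega) h1)
    · rw [if_neg hl] at h1 ⊢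
      have hr := rank_lt (hS.resolve_left hl)
      rw [nilOp_gen_smul]
      refine sub_mem (add_mem (Submodule.smul_mem _ _ (kazhdan_mono (by omega) h1)) ?_)
        (Submodule.smul_mem _ _ ?_)
      · split_ifs with hik
        · subst hik
          -- `χ` would be nonzero here only for `l = j` and `q = p`, which is the eliminated letter
          -- itself.
          have h4 : ¬ (p + q = 0 ∧ (j' : ℕ) = l + 1) := by
            rintro ⟨h2, h3⟩
            rcases hr with hr | hr | ⟨-, -, rfl, rfl⟩
            · omega
            · omega
            · simp at h2
          have h5 := gen_smul_mem_of_chi_eq_zero hu' (p + q) (by rw [Fin.lt_def]; omega) h4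
          exact kazhdan_mono (by omega) h5
        · exact zero_mem _
      -- With `l = j + 1` the rank condition forces `k > i + 1`, so the contraction lies strictly
      -- below the subdiagonal.
      · split_ifs with hjl
        · subst hjl
          exact kazhdan_mono (by omega) (gen_smul_mem_of_chi_eq_zero hu' (p + q)
            (i := k) (j := i) (by rw [Fin.lt_def]; omega) (by omega))
        · exact zero_mem _

/-- A word containing the letter `y = z p i j` can be rewritten, up to terms of lower degree, with
this letter in front. -/
theorem word_mem_of_remaining {n : ℕ} {p : Fin 2} {i j : Fin n} (hij : i ≤ j) (hj : (j : ℕ) + 1 ≠ n)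
    {d : ℤ} {v : WhittakerModule n} (hv : IsWord letter (Remaining (rank p i j + 1)) d v) :
    v ∈ wordSpan letter (Remaining (rank p i j)) d ⊔
      ((kazhdan n (d - (j - i + 1))).map (leftMul (ι n (gen p i j))) ⊔ kazhdan n (d - 1)) := by
  induction hv with
  | one h => exact Submodule.mem_sup_left (Submodule.subset_span (.one h))
  | @cons d u q k l hkl hS hu ih =>
    by_cases h : q = p ∧ k = i ∧ l = j
    · obtain ⟨rfl, rfl, rfl⟩ := h
      refine Submodule.mem_sup_right (Submodule.mem_sup_left ⟨u, ?_, ?_⟩)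
      · exact wordSpan_letter_le _ _ (Submodule.subset_span hu)
      · rw [letter, if_neg hj]; rfl
    · have hS' : Remaining (rank p i j) q k l := by
        refine hS.imp_right fun h1 => ?_
        rcases (Nat.lt_succ_iff.1 h1).lt_or_eq with h2 | h2
        · exact h2
        · exact absurd (eq_of_rank_eq hij hkl h2) h
      obtain ⟨w, hw, x', hx', rfl⟩ := Submodule.mem_sup.1 ih
      obtain ⟨_, ⟨y, hy, rfl⟩, x, hx, rfl⟩ := Submodule.mem_sup.1 hx'
      rw [smul_add, smul_add]
      have hxl : letter q k l • x ∈ kazhdan n (d - 1) :=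
        kazhdan_mono (by omega) (letter_smul_mem hx q k l)
      refine add_mem (Submodule.mem_sup_left (smul_mem_wordSpan hkl hS' hw)) (add_mem ?_
        (Submodule.mem_sup_right (Submodule.mem_sup_right hxl)))
      refine Submodule.mem_sup_right ?_
      have h1 := gen_letter_supercomm_mem hy p q i j k l
      set s : ℂ := (-1 : ℂ) ^ ((p : ℕ) * (q : ℕ)) with hs
      have hss : s * s = 1 := by rw [hs, ← mul_pow]; simp
      have h2 : letter q k l • leftMul (ι n (gen p i j)) y =
          leftMul (ι n (gen p i j)) (s • letter q k l • y) -
          s • (ι n (gen p i j) • letter q k l • y - s • letter q k l • ι n (gen p i j) • y) := by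
        rw [smul_sub, smul_smul s s, hss, one_smul, map_smul]
        simp
      rw [h2]
      exact sub_mem (Submodule.mem_sup_left (Submodule.mem_map_of_mem (Submodule.smul_mem _ _
          (kazhdan_mono (by omega) (letter_smul_mem hy q k l)))))
        (Submodule.mem_sup_right (Submodule.smul_mem _ _ (kazhdan_mono (by omega) h1)))

/-- The identity `∂y = 1`: the supercommutator of the dual pair is the even subdiagonal `e_{j+1,j}`,
which acts as the identity to top order. -/
theorem nilOp_gen_smul_sub_mem {n : ℕ} (p : Fin 2) {i j j' : Fin n} (hj : (j' : ℕ) = j + 1)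
    {d : ℤ} {v : WhittakerModule n} (hv : v ∈ kazhdan n d) :
    nilOp p j' i (ι n (gen p i j) • v) -
      ((-1 : ℂ) ^ (p : ℕ) • ι n (gen p i j) • nilOp p j' i v + v) ∈ kazhdan n (d - 1) := by
  have hpp : p + p = 0 := by fin_cases p <;> rfl
  have hs : (-1 : ℂ) ^ ((p : ℕ) * (p : ℕ)) = (-1 : ℂ) ^ (p : ℕ) := by fin_cases p <;> simp
  rw [nilOp_gen_smul, if_pos rfl, if_neg (by rintro rfl; omega), smul_zero, sub_zero, hs, hpp,
    add_sub_add_left_eq_sub]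
  exact gen_sub_self_mem hv hj

/-- The operator `c + y ∂`, with `c ≥ 1` and `y` even, is injective on the associated graded
space. -/
theorem mem_of_euler_mem {n : ℕ} {i j j' : Fin n} (hij : i ≤ j) (hj : (j' : ℕ) = j + 1) (N : ℕ) :
    ∀ (d : ℤ) (c : ℕ) (v : WhittakerModule n), d < N → 1 ≤ c → v ∈ kazhdan n d →
      (c : ℂ) • v + ι n (gen 0 i j) • nilOp 0 j' i v ∈ kazhdan n (d - 1) → v ∈ kazhdan n (d - 1) := by
  have hij' : (i : ℕ) ≤ j := hij
  have hlt : i < j' := by rw [Fin.lt_def]; omega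
  induction N with
  | zero =>
    intro d c v hd _ hv _
    rw [kazhdan, wordSpan_neg (by simpa using hd)] at hv
    rw [(Submodule.mem_bot ℂ).1 hv]
    exact zero_mem _
  | succ N ih =>
    intro d c v hd hc hv h
    have hD : nilOp 0 j' i v ∈ kazhdan n (d + i - j') := nilOp_mem hv 0 hlt
    have h1 := nilOp_mem h 0 hlt
    have h2 := nilOp_gen_smul_sub_mem (i := i) 0 hj hD
    rw [map_add, map_smul] at h1
    have h3 := sub_mem (kazhdan_mono (d' := d + i - j' - 1) (by omega) h1) h2
    -- Applying `∂` to `c v + y ∂v` gives `(c + 1) ∂v + y ∂(∂v)`, so induction applies to `∂v`,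
    -- whose degree is smaller, with `c + 1` in place of `c`.
    have h4 : nilOp 0 j' i v ∈ kazhdan n (d + i - j' - 1) := by
      refine ih _ (c + 1) _ (by push_cast at hd; omega) (by omega) hD ?_
      convert h3 using 1
      simp only [Fin.val_zero, pow_zero, one_smul, Nat.cast_add, Nat.cast_one, add_smul]
      abel
    have h5 := sub_mem h (kazhdan_mono (d' := d - 1) (by omega) (gen_smul_mem h4 0 i j))
    rw [add_sub_cancel_right] at h5
    have h6 := Submodule.smul_mem _ ((c : ℂ)⁻¹) h5
    rwa [smul_smul, inv_mul_cancel₀ (by exact_mod_cast (by omega : c ≠ 0)), one_smul] at h6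

/-- For odd `y`, `y²` is half the supercommutator of `y` with itself, so its degree is one less than
expected. -/
theorem gen_one_smul_gen_one_smul_mem {n : ℕ} (i j : Fin n) {d : ℤ} {v : WhittakerModule n}
    (hv : v ∈ kazhdan n d) :
    ι n (gen 1 i j) • ι n (gen 1 i j) • v ∈ kazhdan n (d + (j - i) + (j - i + 1)) := by
  have h := gen_power_supercomm_mem hv 1 1 1 i j i j
  rw [power_one] at h
  have h2 := Submodule.smul_mem _ ((1 / 2 : ℂ)) h
  convert h2 using 1
  · norm_num
  · simp only [Fin.val_one, mul_one, pow_one, neg_one_smul, sub_neg_eq_add, ← two_smul ℂ, smul_smul]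
    norm_num

/-- If `y v` is annihilated by `∂` up to lower terms, then `y v` has lower degree. -/
theorem gen_smul_mem_of_nilOp_mem {n : ℕ} (p : Fin 2) {i j j' : Fin n} (hij : i ≤ j)
    (hj : (j' : ℕ) = j + 1) {d : ℤ} {v : WhittakerModule n} (hv : v ∈ kazhdan n d)
    (h : nilOp p j' i (ι n (gen p i j) • v) ∈ kazhdan n (d - 1)) :
    ι n (gen p i j) • v ∈ kazhdan n (d + (j - i)) := by
  have hij' : (i : ℕ) ≤ j := hij
  have h1 := sub_mem h (nilOp_gen_smul_sub_mem (i := i) p hj hv)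
  rw [sub_sub_cancel] at h1
  fin_cases p
  · have h2 : v ∈ kazhdan n (d - 1) := by
      refine mem_of_euler_mem hij hj (d.toNat + 1) d 1 v (by omega) le_rfl hv ?_
      simpa [add_comm] using h1
    exact kazhdan_mono (by omega) (gen_smul_mem h2 0 i j)
  -- In the odd case `h1` bounds `v - y ∂v`. Multiplying by `y` compares `y v` with `y² ∂v`, which
  -- has already dropped.
  · have hD : nilOp 1 j' i v ∈ kazhdan n (d + i - j') :=
      nilOp_mem hv 1 (by rw [Fin.lt_def]; omega)
    have h2 := gen_smul_mem h1 1 i j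
    have h3 := gen_one_smul_gen_one_smul_mem i j hD
    have h4 := add_mem (kazhdan_mono (d' := d + (j - i)) (by omega) h2)
      (kazhdan_mono (d' := d + (j - i)) (by omega) h3)
    convert h4 using 1
    simp

/-- Eliminates the letter `y` of rank `r`, if there is one. With `v = w + y u + x` and `x` of lower
degree, `∂` kills `v` exactly and `w` to top order, so `∂(y u)` is small and `y u` joins the lower
terms. -/
theorem mem_remaining_of_succ {n : ℕ} {d : ℤ} {v : WhittakerModule n}
    (hv : v ∈ whittakerVectors n) (r : ℕ)
    (h : v ∈ wordSpan letter (Remaining (r + 1)) d ⊔ kazhdan n (d - 1)) :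
    v ∈ wordSpan letter (Remaining r) d ⊔ kazhdan n (d - 1) := by
  by_cases hr : ∃ (p : Fin 2) (i j : Fin n), i ≤ j ∧ (j : ℕ) + 1 ≠ n ∧ rank p i j = r
  · obtain ⟨p, i, j, hij, hj, rfl⟩ := hr
    have hij' : (i : ℕ) ≤ j := hij
    have hjn := j.2
    set j' : Fin n := ⟨j + 1, by omega⟩ with hj'
    have hjj' : (j' : ℕ) = j + 1 := rfl
    have hlt : i < j' := by rw [Fin.lt_def]; omega
    have h0 : nilOp p j' i v = 0 := by
      rw [nilOp_apply, hv _ (gen_mem_nilM p hlt), sub_self]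
    have h1 : v ∈ wordSpan letter (Remaining (rank p i j)) d ⊔
        ((kazhdan n (d - (j - i + 1))).map (leftMul (ι n (gen p i j))) ⊔ kazhdan n (d - 1)) :=
      (sup_le (Submodule.span_le.2 fun w hw => word_mem_of_remaining hij hj hw)
        (le_sup_of_le_right le_sup_right)) h
    obtain ⟨w, hw, x', hx', rfl⟩ := Submodule.mem_sup.1 h1
    obtain ⟨_, ⟨y, hy, rfl⟩, x, hx, rfl⟩ := Submodule.mem_sup.1 hx'
    rw [leftMul_apply] at h0 ⊢
    have hDw : nilOp p j' i w ∈ kazhdan n (d - (j - i + 1) - 1) :=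
      map_mem_of_word (fun _ hu => nilOp_word_mem hij hjj' hu) hw
    have hDx' := nilOp_mem hx p hlt
    have hDx : nilOp p j' i x ∈ kazhdan n (d - (j - i + 1) - 1) :=
      kazhdan_mono (by rw [hjj']; push_cast; omega) hDx'
    have hDy : nilOp p j' i (ι n (gen p i j) • y) ∈ kazhdan n (d - (j - i + 1) - 1) := by
      rw [map_add, map_add, ← add_assoc, add_right_comm, add_eq_zero_iff_neg_eq] at h0
      rw [← h0]
      exact neg_mem (add_mem hDw hDx)
    have hyy := gen_smul_mem_of_nilOp_mem p hij hjj' hy hDy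
    exact add_mem (Submodule.mem_sup_left hw) (Submodule.mem_sup_right
      (add_mem (kazhdan_mono (by omega) hyy) hx))
  · have hle : wordSpan letter (Remaining (r + 1)) d ≤ wordSpan letter (n := n) (Remaining r) d := by
      refine Submodule.span_mono fun w hw => ?_
      clear h hv
      induction hw with
      | one h => exact .one h
      | cons p i j hij hS _ ih =>
        refine .cons p i j hij ?_ ih
        by_cases hj : (j : ℕ) + 1 = n
        · exact .inl hj
        · exact .inr ((Nat.lt_succ_iff.1 (hS.resolve_left hj)).lt_of_ne fun h =>
            hr ⟨p, i, j, hij, hj, h⟩)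
    exact sup_le_sup_right hle _ h

theorem whittaker_mem_wordSpan_lastColumn {n : ℕ} {d : ℤ} {v : WhittakerModule n}
    (hv : v ∈ whittakerVectors n) (hd : v ∈ kazhdan n d) :
    v ∈ wordSpan letter (fun _ _ j => (j : ℕ) + 1 = n) d ⊔ kazhdan n (d - 1) := by
  have h : ∀ r : ℕ, v ∈ wordSpan letter (Remaining r) d ⊔ kazhdan n (d - 1) →
      v ∈ wordSpan letter (Remaining 0) d ⊔ kazhdan n (d - 1) := by
    intro r
    induction r with
    | zero => exact id
    | succ r ih => exact fun h => ih (mem_remaining_of_succ hv r h)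
  -- This number exceeds every rank, so initially all letters are allowed.
  have h1 := h ((n * n + n) * 2 + 2) (Submodule.mem_sup_left (wordSpan_mono le_rfl ?_
    (kazhdan_le_wordSpan_letter (d.toNat + 1) d (by omega) hd)))
  · exact sup_le_sup_right (wordSpan_mono le_rfl fun p i j h => h.resolve_right (by simp)) _ h1
  · intro p i j _
    refine .inr ?_
    have hi := i.2
    have hp := p.2
    have h2 : ((j : ℕ) - i) * n ≤ n * n := Nat.mul_le_mul_right n (by omega)
    rw [rank]
    omega

-- Generation of `W_χ` and lifting to invariants

/-- The elements of `W_χ` given by `π(e_{n,1}^{(m)})` and `π(f_{n,1}^{(m)})`, `n ≤ m ≤ 2n - 1`. -/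
def generators (n : ℕ) (hn : 0 < n) : Set (FiniteW n) :=
  {w : FiniteW n | ∃ m ∈ Finset.Icc n (2 * n - 1),
      (wEquiv n w : WhittakerModule n) =
          proj n (eElt m ⟨n - 1, Nat.sub_lt hn one_pos⟩ ⟨0, hn⟩) ∨
        (wEquiv n w : WhittakerModule n) =
          proj n (fElt m ⟨n - 1, Nat.sub_lt hn one_pos⟩ ⟨0, hn⟩)}

theorem proj_mem_whittakerVectors {n : ℕ} {u : Env n} (hu : u ∈ adInvariants n) :
    proj n u ∈ whittakerVectors n := by
  rw [← wEquiv_invariantsToW ⟨u, hu⟩]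
  exact (wEquiv n _).2

theorem invariantsToW_power_mem {n : ℕ} (hn : 0 < n) (m : ℕ) (hm : m ∈ Finset.Icc n (2 * n - 1))
    (p : Fin 2) (h : power m p ⟨n - 1, Nat.sub_lt hn one_pos⟩ ⟨0, hn⟩ ∈ adInvariants n) :
    invariantsToW n ⟨_, h⟩ ∈ generators n hn := by
  refine ⟨m, hm, ?_⟩
  rw [wEquiv_invariantsToW]
  fin_cases p
  · exact .inl (by simp [power])
  · exact .inr (by simp [power])

/-- The Whittaker vectors coming from `ad m`-invariants whose image in `W_χ` lies in the subalgebra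
generated by `generators`. -/
def generatedVectors (n : ℕ) (hn : 0 < n) : Submodule ℂ (WhittakerModule n) :=
  ((Subalgebra.toSubmodule ((Algebra.adjoin ℂ (generators n hn)) ⊓
    (invariantsToW n).range)).map (wEquiv n).toLinearMap).map (whittakerVectors n).subtype

theorem wEquiv_mem_generatedVectors {n : ℕ} (hn : 0 < n) (w : FiniteW n) :
    (wEquiv n w : WhittakerModule n) ∈ generatedVectors n hn ↔
      w ∈ Algebra.adjoin ℂ (generators n hn) ∧ w ∈ (invariantsToW n).range := by
  constructor
  · rintro ⟨_, ⟨w', hw', rfl⟩, h⟩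
    have h1 : w' = w := (wEquiv n).injective (Subtype.ext h)
    exact h1 ▸ hw'
  · exact fun h => ⟨_, ⟨w, h, rfl⟩, rfl⟩

/-- A word in last-column letters is `π` of a product of `ad m`-invariants, so it lies in the
generated subalgebra and lifts to an invariant at once. -/
theorem wordSpan_lastColumn_le {n : ℕ} (hn : 0 < n) (d : ℤ) :
    wordSpan letter (fun _ _ j => (j : ℕ) + 1 = n) d ≤ generatedVectors n hn := by
  refine Submodule.span_le.2 fun v hv => ?_
  have key : ∃ u : adInvariants n, proj n (u : Env n) = v ∧
      invariantsToW n u ∈ Algebra.adjoin ℂ (generators n hn) := by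
    induction hv with
    | one _ => exact ⟨1, rfl, by rw [map_one]; exact one_mem _⟩
    | @cons d v p i j _ hj _ ih =>
      obtain ⟨u, rfl, hu⟩ := ih
      have hi := i.2
      obtain rfl : j = ⟨n - 1, Nat.sub_lt hn one_pos⟩ := by ext; simp; omega
      have ht := power_mem_adInvariants (2 * n - 1 - i) p
        (k := ⟨n - 1, Nat.sub_lt hn one_pos⟩) (l := ⟨0, hn⟩) rfl rfl
      refine ⟨⟨_, ht⟩ * u, ?_, ?_⟩
      · rw [letter, if_pos hj, ← map_smul]
        rfl
      · rw [map_mul]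
        exact mul_mem (Algebra.subset_adjoin (invariantsToW_power_mem hn _
          (Finset.mem_Icc.2 ⟨by omega, by omega⟩) p ht)) hu
  obtain ⟨u, rfl, hu⟩ := key
  rw [← wEquiv_invariantsToW]
  exact (wEquiv_mem_generatedVectors hn _).2 ⟨hu, u, rfl⟩

theorem generatedVectors_le (n : ℕ) (hn : 0 < n) : generatedVectors n hn ≤ whittakerVectors n :=
  Submodule.map_subtype_le _ _

/-- Subtracting the last-column part `w`, itself a Whittaker vector, leaves a Whittaker vector of
lower degree. -/
theorem whittaker_mem_generatedVectors {n : ℕ} (hn : 0 < n) (N : ℕ) :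
    ∀ (d : ℤ) (v : WhittakerModule n), d < N → v ∈ whittakerVectors n → v ∈ kazhdan n d →
      v ∈ generatedVectors n hn := by
  induction N with
  | zero =>
    intro d v hd _ hv
    rw [kazhdan, wordSpan_neg (by simpa using hd)] at hv
    rw [(Submodule.mem_bot ℂ).1 hv]
    exact zero_mem _
  | succ N ih =>
    intro d v hd hv hvd
    obtain ⟨w, hw, x, hx, rfl⟩ :=
      Submodule.mem_sup.1 (whittaker_mem_wordSpan_lastColumn hv hvd)
    have hw' := wordSpan_lastColumn_le hn d hw
    refine add_mem hw' (ih (d - 1) x (by push_cast at hd; omega) ?_ hx)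
    have h := sub_mem hv (generatedVectors_le n hn hw')
    rwa [add_sub_cancel_left] at h

theorem mem_adjoin_and_range {n : ℕ} (hn : 0 < n) (w : FiniteW n) :
    w ∈ Algebra.adjoin ℂ (generators n hn) ∧ w ∈ (invariantsToW n).range := by
  obtain ⟨d, hd⟩ := exists_mem_kazhdan (wEquiv n w : WhittakerModule n)
  exact (wEquiv_mem_generatedVectors hn w).1
    (whittaker_mem_generatedVectors hn (d + 1) d _ (by push_cast; omega) (wEquiv n w).2 hd)

end QueerW

theorem mainTheorem8 (n : ℕ) (hn : 0 < n) :
    -- the elements `π(e_{n,1}^{(m)})` and `π(f_{n,1}^{(m)})` lie in `W_χ`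
    (∀ m ∈ Finset.Icc n (2 * n - 1),
      QueerW.proj n (QueerW.eElt m ⟨n - 1, Nat.sub_lt hn one_pos⟩ ⟨0, hn⟩) ∈
          QueerW.whittakerVectors n ∧
        QueerW.proj n (QueerW.fElt m ⟨n - 1, Nat.sub_lt hn one_pos⟩ ⟨0, hn⟩) ∈
          QueerW.whittakerVectors n) ∧
    -- they generate the algebra `W_χ`
    Algebra.adjoin ℂ {w : QueerW.FiniteW n | ∃ m ∈ Finset.Icc n (2 * n - 1),
      (QueerW.wEquiv n w : QueerW.WhittakerModule n) =
          QueerW.proj n (QueerW.eElt m ⟨n - 1, Nat.sub_lt hn one_pos⟩ ⟨0, hn⟩) ∨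
        (QueerW.wEquiv n w : QueerW.WhittakerModule n) =
          QueerW.proj n (QueerW.fElt m ⟨n - 1, Nat.sub_lt hn one_pos⟩ ⟨0, hn⟩)} = ⊤ ∧
    -- the natural homomorphism `U(Q(n))^{ad m} → W_χ` is surjective
    Function.Surjective (QueerW.invariantsToW n) := by
  refine ⟨fun m _ => ⟨?_, ?_⟩, ?_, ?_⟩
  · have h := QueerW.power_mem_adInvariants m 0 (k := ⟨n - 1, Nat.sub_lt hn one_pos⟩)
      (l := ⟨0, hn⟩) rfl rfl
    rw [QueerW.power, if_pos rfl] at h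
    exact QueerW.proj_mem_whittakerVectors h
  · have h := QueerW.power_mem_adInvariants m 1 (k := ⟨n - 1, Nat.sub_lt hn one_pos⟩)
      (l := ⟨0, hn⟩) rfl rfl
    rw [QueerW.power, if_neg one_ne_zero] at h
    exact QueerW.proj_mem_whittakerVectors h
  · exact eq_top_iff.2 fun w _ => (QueerW.mem_adjoin_and_range hn w).1
  · exact fun w => (QueerW.mem_adjoin_and_range hn w).2
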